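/- Algebras are considered in the language $\langle \oplus, \neg, 0, \exists, \forall\rangle$ of type $(2,1,0,1,1)$, with the abbreviations $1 := \neg 0$, $x \to y := \neg x \oplus y$, $x * y := \neg(\neg x \oplus \neg y)$, $x \vee y := (x \to y) \to y$ and $x \wedge y := \neg(\neg x \vee \neg y)$. A *monadic MV-algebra* is an algebra $\langle \mathbf{A}, \exists, \forall\rangle$ such that $\mathbf{A} = \langle A, \oplus, \neg, 0\rangle$ is an MV-algebra and the following identities hold: $$\forall x \to x \approx 1,\qquad \forall(x \to \forall y) \approx \exists x \to \forall y,\qquad \forall(\forall x \to y) \approx \forall x \to \forall y,$$ $$\forall(\exists x \vee y) \approx \exists x \vee \forall y,\qquad \exists(x * x) \approx \exists x * \exists x.$$ For a natural number $k$, let $\mathbb{MMV}_k$ be the variety of all monadic MV-algebras (of width $\le k$) that satisfy the identity $$\bigwedge_{1 \le i < j \le k+1} \forall(x_i \vee x_j) \to \bigvee_{i=1}^{k+1} \forall x_i \approx 1, \tag{$W_k$}$$ where an empty meet is $1$. Let $[0,1]_{\text{Ł}}$ be the standard MV-algebra on the real unit interval, with $x \oplus y = \min(1, x+y)$ and $\neg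 x = 1 - x$, and let $\langle [0,1]_{\text{Ł}}^k, \exists_\vee, \forall_\wedge\rangle$ be the power $[0,1]_{\text{Ł}}^k$ with pointwise MV-operations, where, for $f \in [0,1]^k$, $\exists_\vee f$ and $\forall_\wedge f$ are the constant tuples with value $\sup_i f(i)$ and $\inf_i f(i)$, respectively (for $k = 0$ this is the one-element algebra). A *quasi-identity* is an implication $s_1 \approx t_1 \mathbin{\&} \cdots \mathbin{\&} s_n \approx t_n \Rightarrow s \approx t$ (with $n \ge 0$) between terms of the language, understood as universally quantified; a *quasivariety* is the class of all algebras satisfying some set of quasi-identities; the quasivariety *generated by* an algebra is the least quasivariety to which it belongs. **Corollary.** For every natural number $k$, $\mathbb{MMV}_k$ is the quasivariety generated by the single algebra $\langle [0,1]_{\text{Ł}}^k, \exists_\vee, \forall_\wedge\rangle$. -/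

import Mathlib

universe u v

namespace MonadicMV

open FirstOrder

/-- Operation symbols of monadic MV-algebras: truncated sum, negation, zero and the two
quantifiers. -/
inductive Func : ℕ → Type
  | add : Func 2
  | neg : Func 1
  | zero : Func 0
  | ex : Func 1
  | all : Func 1

/-- The (purely algebraic) language of monadic MV-algebras. -/
def lang : FirstOrder.Language.{0, 0} where
  Functions := Func
  Relations := fun _ => Empty

section Operations

variable {A : Type*} [lang.Structure A]

/-- Truncated sum. -/
def oplus (x y : A) : A := FirstOrder.Language.Structure.funMap (L := lang) Func.add ![x, y]

/-- Negation. -/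
def neg (x : A) : A := FirstOrder.Language.Structure.funMap (L := lang) Func.neg ![x]

/-- The constant `0`. -/
def zero : A := FirstOrder.Language.Structure.funMap (L := lang) Func.zero ![]

/-- The existential quantifier. -/
def ex (x : A) : A := FirstOrder.Language.Structure.funMap (L := lang) Func.ex ![x]

/-- The universal quantifier. -/
def all (x : A) : A := FirstOrder.Language.Structure.funMap (L := lang) Func.all ![x]

/-- `1 = ¬0`. -/
def one : A := neg zero

/-- `x → y = ¬x ⊕ y`. -/
def imp (x y : A) : A := oplus (neg x) y

/-- `x * y = ¬(¬x ⊕ ¬y)`. -/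
def conj (x y : A) : A := neg (oplus (neg x) (neg y))

/-- `x ∨ y = (x → y) → y`. -/
def sup (x y : A) : A := imp (imp x y) y

/-- `x ∧ y = ¬(¬x ∨ ¬y)`. -/
def inf (x y : A) : A := neg (sup (neg x) (neg y))

/-- Finite meet `x₁ ∧ (x₂ ∧ (⋯ ∧ 1))`. -/
def bigInf (l : List A) : A := l.foldr inf one

/-- Finite join `x₁ ∨ (x₂ ∨ (⋯ ∨ 0))`. -/
def bigSup (l : List A) : A := l.foldr sup zero

end Operations

/-- The `⟨⊕, ¬, 0⟩`-reduct of `A` is an MV-algebra. -/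
structure IsMV (A : Type*) [lang.Structure A] : Prop where
  add_assoc : ∀ x y z : A, oplus x (oplus y z) = oplus (oplus x y) z
  add_comm : ∀ x y : A, oplus x y = oplus y x
  add_zero : ∀ x : A, oplus x zero = x
  neg_neg : ∀ x : A, neg (neg x) = x
  add_one : ∀ x : A, oplus x (neg zero) = neg zero
  lukasiewicz : ∀ x y : A, oplus (neg (oplus (neg x) y)) y = oplus (neg (oplus (neg y) x)) x

/-- `A` is a monadic MV-algebra. -/
structure IsMonadicMV (A : Type*) [lang.Structure A] : Prop extends IsMV A where
  all_imp_self : ∀ x : A, imp (all x) x = one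
  all_imp_all : ∀ x y : A, all (imp x (all y)) = imp (ex x) (all y)
  all_all_imp : ∀ x y : A, all (imp (all x) y) = imp (all x) (all y)
  all_ex_sup : ∀ x y : A, all (sup (ex x) y) = sup (ex x) (all y)
  ex_conj_self : ∀ x : A, ex (conj x x) = conj (ex x) (ex x)

/-- The list of all pairs `(i, j)` of indices with `i < j`. -/
def ltPairs (n : ℕ) : List (Fin n × Fin n) :=
  (List.finRange n ×ˢ List.finRange n).filter fun p => p.1 < p.2

/-- The identity `W_k`: `⋀_{i < j} ∀(x_i ∨ x_j) → ⋁_i ∀ x_i ≈ 1`, where the indices `i`, `j`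
range over a set of `k + 1` elements. -/
def SatisfiesW (k : ℕ) (A : Type*) [lang.Structure A] : Prop :=
  ∀ x : Fin (k + 1) → A,
    imp (bigInf ((ltPairs (k + 1)).map fun p => all (sup (x p.1) (x p.2))))
      (bigSup ((List.finRange (k + 1)).map fun i => all (x i))) = one

/-- Algebras (with carrier in `Type u`) in the language of monadic MV-algebras. -/
abbrev Alg := CategoryTheory.Bundled.{u} lang.Structure

instance (A : Alg.{u}) : lang.Structure A := A.str

/-- The variety `MMV_k` of monadic MV-algebras of width at most `k`. -/
def MMV (k : ℕ) : Set Alg.{u} := {A | IsMonadicMV A ∧ SatisfiesW k A}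

/-- A quasi-identity `s₁ ≈ t₁ & ⋯ & sₙ ≈ tₙ ⇒ s ≈ t`, with variables indexed by `ℕ`. -/
structure QuasiIdentity where
  /-- The finitely many premises `sᵢ ≈ tᵢ`. -/
  premises : List (lang.Term ℕ × lang.Term ℕ)
  /-- The conclusion `s ≈ t`. -/
  conclusion : lang.Term ℕ × lang.Term ℕ

/-- The quasi-identity `q` holds in `A` (under all valuations). -/
def QuasiIdentity.Holds (q : QuasiIdentity) (A : Type*) [lang.Structure A] : Prop :=
  ∀ v : ℕ → A, (∀ e ∈ q.premises, e.1.realize v = e.2.realize v) →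
    q.conclusion.1.realize v = q.conclusion.2.realize v

/-- The quasivariety axiomatized by a set of quasi-identities. -/
def quasivariety (S : Set QuasiIdentity) : Set Alg.{u} := {A | ∀ q ∈ S, q.Holds A}

/-- The quasivariety generated by `B`: the intersection of all the quasivarieties to which `B`
belongs. -/
def generatedQuasivariety (B : Alg.{v}) : Set Alg.{u} :=
  ⋂ (S : Set QuasiIdentity) (_ : B ∈ quasivariety.{v} S), quasivariety.{u} S

/-- Truncated addition `min 1 (x + y)` on the real unit interval. -/
noncomputable def truncAdd (x y : unitInterval) : unitInterval :=
  ⟨min 1 ((x : ℝ) + y), le_min zero_le_one (add_nonneg x.2.1 y.2.1), min_le_left _ _⟩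

/-- The carrier of the functional algebra: all maps from `X` to the real unit interval. -/
abbrev Cube (X : Type*) : Type _ := X → unitInterval

/-- The Łukasiewicz operations act pointwise, and the quantifiers send `f` to the constant maps
with value the supremum, respectively the infimum, of the values of `f`. -/
noncomputable instance (X : Type*) : lang.Structure (Cube X) where
  funMap := fun {_} f => match f with
    | Func.add => fun a => fun i : X => truncAdd (a 0 i) (a 1 i)
    | Func.neg => fun a => fun i : X => unitInterval.symm (a 0 i)
    | Func.zero => fun _ => fun _ : X => (0 : unitInterval)
    | Func.ex => fun a => fun _ : X => ⨆ j : X, (a 0 j : unitInterval)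
    | Func.all => fun a => fun _ : X => ⨅ j : X, (a 0 j : unitInterval)
  RelMap := fun {_} r => nomatch r

/-- The algebra `⟨[0,1]_Ł^k, ∃_∨, ∀_∧⟩`. -/
noncomputable def stdAlg (k : ℕ) : Alg.{0} := ⟨Cube (Fin k), inferInstance⟩

end MonadicMV

/-! One inclusion is a verification: the cube satisfies the axioms and `W_k`, and identities are
quasi-identities. For the other, let the premises of a quasi-identity hold in an algebra `A` of
`MMV_k` at a valuation where the two sides of the conclusion differ, say `a ≰ b` for their values in
some order. It suffices to map the finitely many values of subterms into `[0,1]^k`, respecting the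
operations and separating `a` from `b`.

Write `Q` for `∀`; then `∃ = ¬∀¬`. As `Q (a → b) ≠ 1`, some prime filter `P₀` omits it. Consider the
filters maximal among those whose `Q`-fixed elements lie in `P₀`, and containing all fixed elements
of `P₀`. They are prime and pairwise incomparable, hence separated by pairwise orthogonal elements,
so `W_k` allows at most `k` of them (`IsQuantifier.exists_primes`). For every `x` one of them
contains `x → Q x`: the image of `Q x` lies below that of `x` in each chain `A / P i` and equals it
in at least one. All these chains contain the chain of fixed elements modulo `P₀`.

Each chain is the unit interval of its Chang group `G i`, and all `G i` contain the group `H` of the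
common chain. By `exists_compatible_pos`, homomorphisms `G i → ℚ` that agree on `H` can be made
positive at finitely many given positive elements: Gordan's theorem applies to the amalgam of the `G
i` over `H`. Dividing by the value of the unit gives the map into the cube
(`IsQuantifier.exists_partial_embedding`). There `Q x` has the same value in every coordinate, below
all values of `x` and equal to one of them, so it goes to the minimum. -/

/-! ### Arithmetic and order of MV-algebras -/

/-- An MV-algebra, with `xᶜ` for the negation and `x + y` for the truncated sum. -/
class MVAlgebra (α : Type*) extends AddCommMonoid α, Compl α where
  compl_compl' : ∀ x : α, xᶜᶜ = x
  add_compl_zero : ∀ x : α, x + 0ᶜ = 0ᶜ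
  luk : ∀ x y : α, (xᶜ + y)ᶜ + y = (yᶜ + x)ᶜ + x

namespace MVAlgebra

section Basic

variable {α : Type*} [MVAlgebra α]

instance (priority := 100) : One α := ⟨0ᶜ⟩

theorem one_def : (1 : α) = 0ᶜ := rfl

@[simp] theorem cc (x : α) : xᶜᶜ = x := compl_compl' x

@[simp] theorem compl_zero : (0 : α)ᶜ = 1 := rfl

@[simp] theorem compl_one : (1 : α)ᶜ = 0 := cc 0

@[simp] theorem add_one (x : α) : x + 1 = 1 := add_compl_zero x

@[simp] theorem one_add (x : α) : 1 + x = 1 := by rw [add_comm, add_one]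

theorem compl_injective : Function.Injective (compl : α → α) := fun x y h => by
  rw [← cc x, h, cc]

@[simp] theorem compl_add_self (x : α) : xᶜ + x = 1 := by
  have := luk x 1
  simpa using this.symm

@[simp] theorem add_compl_self (x : α) : x + xᶜ = 1 := by rw [add_comm, compl_add_self]

instance (priority := 100) : CommMonoid α where
  mul x y := (xᶜ + yᶜ)ᶜ
  mul_assoc x y z := by
    change ((xᶜ + yᶜ)ᶜᶜ + zᶜ)ᶜ = (xᶜ + (yᶜ + zᶜ)ᶜᶜ)ᶜ
    simp only [cc, add_assoc]
  mul_comm x y := congrArg compl (add_comm _ _)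
  one_mul x := by
    change ((1 : α)ᶜ + xᶜ)ᶜ = x
    simp
  mul_one x := by
    change (xᶜ + (1 : α)ᶜ)ᶜ = x
    simp

theorem mul_def (x y : α) : x * y = (xᶜ + yᶜ)ᶜ := rfl

theorem compl_mul (x y : α) : (x * y)ᶜ = xᶜ + yᶜ := by rw [mul_def, cc]

theorem compl_add (x y : α) : (x + y)ᶜ = xᶜ * yᶜ := by simp [mul_def]

@[simp] theorem compl_mul_self (x : α) : xᶜ * x = 0 := by simp [mul_def]

theorem luk_one {x y : α} (h : xᶜ + y = 1) : (yᶜ + x)ᶜ + x = y := by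
  rw [← luk, h, compl_one, zero_add]

instance (priority := 100) : PartialOrder α where
  le x y := xᶜ + y = 1
  le_refl := compl_add_self
  le_trans x y z (hxy : xᶜ + y = 1) (hyz : yᶜ + z = 1) := by
    rw [← luk_one hyz, ← luk_one hxy, add_left_comm, add_left_comm xᶜ, compl_add_self]
    simp
  le_antisymm x y (hxy : xᶜ + y = 1) (hyx : yᶜ + x = 1) := by
    have := luk_one hxy
    rwa [hyx, compl_one, zero_add] at this

theorem le_def {x y : α} : x ≤ y ↔ xᶜ + y = 1 := Iff.rfl

theorem le_iff_exists {x y : α} : x ≤ y ↔ ∃ z, y = x + z := by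
  constructor
  · intro h
    exact ⟨(yᶜ + x)ᶜ, by rw [add_comm, luk_one h]⟩
  · rintro ⟨z, rfl⟩
    rw [le_def, ← add_assoc, compl_add_self, one_add]

theorem zero_le' (x : α) : 0 ≤ x := by simp [le_def]

theorem one_le_iff {x : α} : 1 ≤ x ↔ x = 1 := by simp [le_def]

theorem le_zero_iff' {x : α} : x ≤ 0 ↔ x = 0 :=
  ⟨fun h => le_antisymm h (zero_le' x), fun h => h.le⟩

instance (priority := 100) : IsOrderedAddMonoid α where
  add_le_add_left x y h z := by
    obtain ⟨w, rfl⟩ := le_iff_exists.1 h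
    exact le_iff_exists.2 ⟨w, by rw [add_right_comm]⟩

theorem compl_le_compl {x y : α} (h : x ≤ y) : yᶜ ≤ xᶜ := by
  rw [le_def, cc, add_comm]
  exact h

theorem compl_le_iff {x y : α} : xᶜ ≤ yᶜ ↔ y ≤ x :=
  ⟨fun h => by simpa using compl_le_compl h, compl_le_compl⟩

theorem le_compl_comm {x y : α} : x ≤ yᶜ ↔ y ≤ xᶜ := by
  rw [← compl_le_iff, cc]

theorem compl_le_comm {x y : α} : xᶜ ≤ y ↔ yᶜ ≤ x := by
  rw [← compl_le_iff, cc]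

instance (priority := 100) : IsOrderedMonoid α where
  mul_le_mul_left x y h z := by
    rw [mul_def, mul_def, compl_le_iff]
    exact add_le_add_left (compl_le_compl h) _

/-- Residuation. -/
theorem mul_le_iff {x y z : α} : x * y ≤ z ↔ x ≤ yᶜ + z := by
  rw [le_def, le_def, compl_mul, add_assoc]

theorem le_add_left' (x y : α) : x ≤ y + x := le_iff_exists.2 ⟨y, add_comm _ _⟩

theorem mul_le_left' (x y : α) : x * y ≤ x := by
  rw [mul_le_iff]; exact le_add_left' _ _

theorem mul_le_right' (x y : α) : x * y ≤ y := by
  rw [mul_comm]; exact mul_le_left' _ _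

theorem mul_imp_le (x y : α) : x * (xᶜ + y) ≤ y := by
  rw [mul_comm, mul_le_iff]

theorem mul_eq_zero_iff {x y : α} : x * y = 0 ↔ x ≤ yᶜ := by
  rw [← le_zero_iff', mul_le_iff, add_zero]

theorem add_eq_one_iff {x y : α} : x + y = 1 ↔ xᶜ ≤ y := by
  rw [le_def, cc]

instance (priority := 100) : Lattice α where
  sup x y := (xᶜ + y)ᶜ + y
  le_sup_left x y := by
    rw [luk]; exact le_add_left' _ _
  le_sup_right x y := le_add_left' _ _
  sup_le x y z hx hy := by
    have h : (xᶜ + y)ᶜ + y ≤ (zᶜ + y)ᶜ + y :=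
      add_le_add_left (compl_le_compl (add_le_add_left (compl_le_compl hx) _)) _
    rw [luk z, le_def.1 hy] at h
    simpa using h
  inf x y := ((xᶜᶜ + yᶜ)ᶜ + yᶜ)ᶜ
  inf_le_left x y := by
    rw [compl_le_comm, luk]; exact le_add_left' _ _
  inf_le_right x y := by
    rw [compl_le_comm]; exact le_add_left' _ _
  le_inf x y z hy hz := by
    rw [le_compl_comm]
    have h : (yᶜᶜ + zᶜ)ᶜ + zᶜ ≤ (xᶜᶜ + zᶜ)ᶜ + zᶜ :=
      add_le_add_left (compl_le_compl (add_le_add_left (compl_le_compl (compl_le_compl hy)) _)) _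
    rw [luk xᶜ, le_def.1 (compl_le_compl hz)] at h
    simpa using h

theorem sup_def (x y : α) : x ⊔ y = (xᶜ + y)ᶜ + y := rfl

theorem inf_def (x y : α) : x ⊓ y = (xᶜ ⊔ yᶜ)ᶜ := rfl

theorem compl_sup' (x y : α) : (x ⊔ y)ᶜ = xᶜ ⊓ yᶜ := by simp [inf_def]

/-- Divisibility. -/
theorem mul_imp (x y : α) : x * (xᶜ + y) = x ⊓ y := by
  rw [inf_comm, inf_def, sup_def, mul_def, cc, add_comm xᶜ, add_comm xᶜ]

theorem compl_mul_add (x y : α) : xᶜ * (x + y) = xᶜ ⊓ y := by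
  simpa using mul_imp xᶜ y

theorem mul_sup' (x y z : α) : x * (y ⊔ z) = x * y ⊔ x * z := by
  apply le_antisymm
  · rw [mul_comm, mul_le_iff]
    apply sup_le
    · rw [← mul_le_iff, mul_comm]; exact le_sup_left
    · rw [← mul_le_iff, mul_comm]; exact le_sup_right
  · exact sup_le (mul_le_mul_right le_sup_left _) (mul_le_mul_right le_sup_right _)

theorem sup_mul' (x y z : α) : (x ⊔ y) * z = x * z ⊔ y * z := by
  simp only [mul_comm _ z, mul_sup']

theorem inf_add_mul_compl (x y : α) : x ⊓ y + x * yᶜ = x := by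
  have h : x * yᶜ ⊔ x = x := sup_eq_right.2 (mul_le_left' _ _)
  rw [sup_comm, sup_def] at h
  have h2 : xᶜ + x * yᶜ = xᶜ ⊔ yᶜ := by
    rw [← compl_injective.eq_iff, compl_sup', compl_add, compl_mul]
    simp [mul_imp]
  rwa [h2, compl_sup', cc, cc] at h

theorem prelinear (x y : α) : (xᶜ + y) ⊔ (yᶜ + x) = 1 := by
  -- Each of `x` and `y` is `m` plus a truncated difference, and `d` is the meet of the two
  -- differences, so `m + d ≤ m`. As `d ≤ mᶜ`, cancelling `m` leaves `d = 0`.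
  have key : (x * yᶜ) ⊓ (y * xᶜ) = 0 := by
    set d := (x * yᶜ) ⊓ (y * xᶜ) with hd
    set m := x ⊓ y with hm
    have h1 : m + d ≤ m := by
      refine le_inf ?_ ?_
      · calc m + d ≤ m + x * yᶜ := add_le_add_right inf_le_left _
          _ = x := inf_add_mul_compl x y
      · calc m + d ≤ m + y * xᶜ := add_le_add_right inf_le_right _
          _ = y := by rw [hm, inf_comm]; exact inf_add_mul_compl y x
    have h2 : d ≤ mᶜ := by
      calc d ≤ yᶜ := inf_le_left.trans (mul_le_right' _ _)
        _ ≤ mᶜ := compl_le_compl inf_le_right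
    have h3 : d = mᶜ * (m + d) := by rw [compl_mul_add, inf_eq_right.2 h2]
    rw [← le_zero_iff', h3]
    calc mᶜ * (m + d) ≤ mᶜ * m := mul_le_mul_right h1 _
      _ = 0 := by simp
  rw [← compl_injective.eq_iff, compl_sup', compl_add, compl_add, compl_one, cc, cc, ← key,
    mul_comm]

theorem add_mul_le (x y z : α) : (x + y) * z ≤ x + y * z := by
  rw [mul_le_iff]
  have : y ≤ zᶜ + y * z := by rw [← mul_le_iff]
  calc x + y ≤ x + (zᶜ + y * z) := add_le_add_right this _
    _ = zᶜ + (x + y * z) := add_left_comm _ _ _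

theorem add_compl_mul_of_le {y x : α} (h : y ≤ x) : y + x * yᶜ = x := by
  have := inf_add_mul_compl x y
  rwa [inf_eq_right.2 h] at this

/-- In the group of a chain, both sides are the part of `x + y + z` above `1`. Splitting off `y`
from `xᶜ` and from `zᶜ` turns both complements into `y + xᶜ * yᶜ + zᶜ * yᶜ`. -/
theorem add_mul_assoc {x y z : α} (hxy : x * y = 0) (hyz : y * z = 0) :
    (x + y) * z = x * (y + z) := by
  have hx : y ≤ xᶜ := by rw [← mul_eq_zero_iff, mul_comm, hxy]
  have hz : y ≤ zᶜ := by rw [← mul_eq_zero_iff, hyz]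
  rw [← compl_injective.eq_iff, compl_mul, compl_mul, compl_add, compl_add]
  nth_rewrite 2 [← add_compl_mul_of_le hx]
  nth_rewrite 1 [← add_compl_mul_of_le hz]
  rw [mul_comm yᶜ, add_left_comm, add_assoc]

/-- In the group of a chain, both sides are `x + y + z - 1`. Here `x` splits as `(y + z)ᶜ + (x * y +
z)`, and multiplying by `y + z` cancels the first summand because the second lies below `y + z`. -/
theorem mul_add_assoc {x y z : α} (hxy : x + y = 1) (hyz : y * z = 0) :
    x * y + z = x * (y + z) := by
  have hx : yᶜ ≤ x := by rwa [← add_eq_one_iff, add_comm]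
  have hz : z ≤ yᶜ := by rw [← mul_eq_zero_iff, mul_comm, hyz]
  have h1 : x = (y + z)ᶜ + (x * y + z) := by
    have h2 := add_compl_mul_of_le hx
    have h3 := add_compl_mul_of_le hz
    rw [cc] at h2
    rw [compl_add, add_comm (x * y), ← add_assoc, add_comm (yᶜ * zᶜ), mul_comm x, h3, mul_comm y,
      h2]
  have h4 : x * y + z ≤ y + z := add_le_add_left (mul_le_right' _ _) _
  have h5 := compl_mul_add (y + z)ᶜ (x * y + z)
  rw [← h1, cc, inf_eq_right.2 h4, mul_comm] at h5
  exact h5.symm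

end Basic

end MVAlgebra

/-! ### Filters and quotients -/

/-- A nontrivial totally ordered MV-algebra. -/
class MVChain (α : Type*) extends MVAlgebra α where
  total : ∀ x y : α, xᶜ + y = 0ᶜ ∨ yᶜ + x = 0ᶜ
  zero_ne : (0 : α) ≠ 0ᶜ

/-- A filter (deductive system) of an MV-algebra. -/
@[ext]
structure MVFilter (α : Type*) [MVAlgebra α] where
  carrier : Set α
  one_mem : 1 ∈ carrier
  mp : ∀ {x y}, x ∈ carrier → xᶜ + y ∈ carrier → y ∈ carrier

namespace MVFilter

open MVAlgebra

variable {α : Type*} [MVAlgebra α]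

instance : SetLike (MVFilter α) α where
  coe := carrier
  coe_injective _ _ h := MVFilter.ext h

instance : PartialOrder (MVFilter α) := .ofSetLike (MVFilter α) α

variable (F : MVFilter α)

theorem one_mem' : (1 : α) ∈ F := F.one_mem

theorem mp' {x y : α} (hx : x ∈ F) (h : xᶜ + y ∈ F) : y ∈ F := F.mp hx h

variable {F}

theorem mem_of_le {x y : α} (hx : x ∈ F) (h : x ≤ y) : y ∈ F :=
  F.mp' hx (by rw [le_def.1 h]; exact F.one_mem)

theorem mul_mem {x y : α} (hx : x ∈ F) (hy : y ∈ F) : x * y ∈ F :=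
  F.mp' hy (mem_of_le hx (mul_le_iff.1 le_rfl))

/-- A set that is closed under products and upwards is a filter. -/
def mk' (S : Set α) (h1 : 1 ∈ S) (hmul : ∀ {x y}, x ∈ S → y ∈ S → x * y ∈ S)
    (hle : ∀ {x y}, x ∈ S → x ≤ y → y ∈ S) : MVFilter α where
  carrier := S
  one_mem := h1
  mp hx h := hle (hmul hx h) (mul_imp_le _ _)

/-- Proper prime filters. -/
class IsPrime (F : MVFilter α) : Prop where
  zero_notMem : (0 : α) ∉ F
  imp_mem : ∀ x y : α, xᶜ + y ∈ F ∨ yᶜ + x ∈ F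

theorem isPrime_of_sup (h0 : (0 : α) ∉ F) (h : ∀ x y : α, x ⊔ y ∈ F → x ∈ F ∨ y ∈ F) :
    F.IsPrime :=
  ⟨h0, fun x y => h _ _ (by rw [prelinear]; exact F.one_mem)⟩

theorem IsPrime.mem_or_mem [hF : F.IsPrime] {x y : α} (h : x ⊔ y ∈ F) : x ∈ F ∨ y ∈ F := by
  rcases hF.imp_mem x y with h1 | h1
  · right
    refine F.mp' h1 ?_
    rwa [sup_def] at h
  · left
    refine F.mp' h1 ?_
    rwa [sup_comm, sup_def] at h

/-- The filter of all `z` with `z ⊔ a ∈ F`. -/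
def residual (F : MVFilter α) (a : α) : MVFilter α where
  carrier := {z | z ⊔ a ∈ F}
  one_mem := mem_of_le F.one_mem le_sup_left
  mp {x y} hx h := by
    -- When the product of the two joins is expanded, every term except `x * (xᶜ + y)` lies below
    -- `a`.
    refine mem_of_le (mul_mem hx h) ?_
    rw [mul_sup', sup_mul', sup_mul']
    refine sup_le (sup_le ?_ ?_) (sup_le ?_ ?_)
    · exact (mul_imp_le _ _).trans le_sup_left
    · exact (mul_le_left' _ _).trans le_sup_right
    · exact (mul_le_right' _ _).trans le_sup_right
    · exact (mul_le_right' _ _).trans le_sup_right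

theorem mem_residual {a z : α} : z ∈ F.residual a ↔ z ⊔ a ∈ F := Iff.rfl

theorem le_residual (a : α) : F ≤ F.residual a := fun _ hz =>
  mem_residual.2 (mem_of_le hz le_sup_left)

/-- The congruence of a filter. -/
def setoid (F : MVFilter α) : Setoid α where
  r x y := xᶜ + y ∈ F ∧ yᶜ + x ∈ F
  iseqv :=
    { refl x := by simp only [compl_add_self]; exact ⟨F.one_mem, F.one_mem⟩
      symm h := ⟨h.2, h.1⟩
      trans {x y z} h h' := by
        have key : ∀ {x y z : α}, xᶜ + y ∈ F → yᶜ + z ∈ F → xᶜ + z ∈ F := fun {x y z} h h' =>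
          mem_of_le (mul_mem h h') (by
            refine (add_mul_le _ _ _).trans (add_le_add_right ?_ _)
            exact mul_imp_le _ _)
        exact ⟨key h.1 h'.1, key h'.2 h.2⟩ }

theorem setoid_add {x y x' y' : α} (h : F.setoid x x') (h' : F.setoid y y') :
    F.setoid (x + y) (x' + y') := by
  have key : ∀ {x y x' y' : α}, xᶜ + x' ∈ F → yᶜ + y' ∈ F → (x + y)ᶜ + (x' + y') ∈ F :=
    fun {x y x' y'} h h' => mem_of_le (mul_mem h h') (by
      rw [← mul_le_iff, mul_comm, ← mul_assoc]
      calc (x + y) * (xᶜ + x') * (yᶜ + y')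
          ≤ (x * (xᶜ + x') + y) * (yᶜ + y') := by
            refine mul_le_mul_left ?_ _
            rw [add_comm x, add_comm _ y]
            exact add_mul_le _ _ _
        _ ≤ x * (xᶜ + x') + y * (yᶜ + y') := add_mul_le _ _ _
        _ ≤ x' + y' := add_le_add (mul_imp_le _ _) (mul_imp_le _ _))
  exact ⟨key h.1 h'.1, key h.2 h'.2⟩

theorem setoid_compl {x x' : α} (h : F.setoid x x') : F.setoid xᶜ x'ᶜ := by
  constructor
  · rw [cc, add_comm]; exact h.2
  · rw [cc, add_comm]; exact h.1

/-- The quotient by a filter. -/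
def Quot (F : MVFilter α) : Type _ := Quotient F.setoid

/-- The projection to the quotient. -/
def proj (F : MVFilter α) (x : α) : F.Quot := Quotient.mk F.setoid x

theorem proj_eq_iff {x y : α} : F.proj x = F.proj y ↔ xᶜ + y ∈ F ∧ yᶜ + x ∈ F :=
  Quotient.eq

theorem proj_eq_one_iff {x : α} : F.proj x = F.proj 1 ↔ x ∈ F := by
  simp [proj_eq_iff, F.one_mem']

instance : Add F.Quot := ⟨Quotient.map₂ (· + ·) fun _ _ h _ _ h' => setoid_add h h'⟩

instance : Zero F.Quot := ⟨F.proj 0⟩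

instance : Compl F.Quot := ⟨Quotient.map compl fun _ _ h => setoid_compl h⟩

instance : MVAlgebra F.Quot where
  nsmul := nsmulRec
  add_assoc := by
    rintro ⟨x⟩ ⟨y⟩ ⟨z⟩; exact congrArg F.proj (add_assoc x y z)
  zero_add := by rintro ⟨x⟩; exact congrArg F.proj (zero_add x)
  add_zero := by rintro ⟨x⟩; exact congrArg F.proj (add_zero x)
  add_comm := by rintro ⟨x⟩ ⟨y⟩; exact congrArg F.proj (add_comm x y)
  compl_compl' := by rintro ⟨x⟩; exact congrArg F.proj (cc x)
  add_compl_zero := by rintro ⟨x⟩; exact congrArg F.proj (add_compl_zero x)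
  luk := by rintro ⟨x⟩ ⟨y⟩; exact congrArg F.proj (luk x y)

theorem proj_add (x y : α) : F.proj (x + y) = F.proj x + F.proj y := rfl

theorem proj_compl (x : α) : F.proj xᶜ = (F.proj x)ᶜ := rfl

instance [hF : F.IsPrime] : MVChain F.Quot where
  total := by
    rintro ⟨x⟩ ⟨y⟩
    exact (hF.imp_mem x y).imp proj_eq_one_iff.2 proj_eq_one_iff.2
  zero_ne h := hF.zero_notMem (proj_eq_one_iff.1 h)

end MVFilter

/-! ### Chains and Chang's group -/

namespace MVChain

open MVAlgebra

variable {α : Type*} [MVChain α]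

theorem le_or_le (x y : α) : x ≤ y ∨ y ≤ x := total x y

theorem zero_ne_one : (0 : α) ≠ 1 := zero_ne

theorem add_eq_one_or (x y : α) : x + y = 1 ∨ x * y = 0 := by
  rcases le_or_le xᶜ y with h | h
  · exact Or.inl (add_eq_one_iff.2 h)
  · right
    rw [mul_comm, mul_eq_zero_iff]
    exact h

theorem mul_eq_zero_of {x y : α} (h : x + y ≠ 1) : x * y = 0 :=
  (add_eq_one_or x y).resolve_left h

theorem mul_ne_one {x y : α} (h : x ≠ 1) : x * y ≠ 1 := fun h' =>
  h (one_le_iff.1 (h' ▸ mul_le_left' x y))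

end MVChain

/-- Chang's group of an MV-chain: the element `⟨n, x⟩` stands for `n + x`. -/
@[ext]
structure ChangGroup (α : Type*) [MVChain α] where
  int : ℤ
  frac : α
  frac_ne : frac ≠ 1

namespace ChangGroup

open MVAlgebra MVChain

variable {α : Type*} [MVChain α]

open Classical in
noncomputable instance : Add (ChangGroup α) where
  -- Addition with carry: once the truncated sum reaches `1`, the excess over `1` is the product of
  -- the fractional parts.
  add g h := if hs : g.frac + h.frac = 1
    then ⟨g.int + h.int + 1, g.frac * h.frac, mul_ne_one g.frac_ne⟩
    else ⟨g.int + h.int, g.frac + h.frac, hs⟩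

theorem add_of_eq {g h : ChangGroup α} (hs : g.frac + h.frac = 1) :
    g + h = ⟨g.int + h.int + 1, g.frac * h.frac, mul_ne_one g.frac_ne⟩ := dif_pos hs

theorem add_of_ne {g h : ChangGroup α} (hs : g.frac + h.frac ≠ 1) :
    g + h = ⟨g.int + h.int, g.frac + h.frac, hs⟩ := dif_neg hs

instance : Zero (ChangGroup α) := ⟨⟨0, 0, zero_ne_one⟩⟩

open Classical in
noncomputable instance : Neg (ChangGroup α) where
  neg g := if h : g.frac = 0 then ⟨-g.int, 0, zero_ne_one⟩
    else ⟨-g.int - 1, g.fracᶜ, fun h' => h (by rw [← cc g.frac, h', compl_one])⟩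

@[simp] theorem zero_int : (0 : ChangGroup α).int = 0 := rfl

@[simp] theorem zero_frac : (0 : ChangGroup α).frac = 0 := rfl

protected theorem add_comm (g h : ChangGroup α) : g + h = h + g := by
  by_cases hs : g.frac + h.frac = 1
  · rw [add_of_eq hs, add_of_eq ((add_comm _ _).trans hs)]
    ext
    · simp [add_comm]
    · exact mul_comm _ _
  · rw [add_of_ne hs, add_of_ne (fun h => hs ((add_comm _ _).trans h))]
    ext
    · exact add_comm _ _
    · exact add_comm _ _

protected theorem zero_add (g : ChangGroup α) : 0 + g = g := by
  rw [add_of_ne (by simpa using g.frac_ne)]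
  ext <;> simp

protected theorem neg_add_cancel (g : ChangGroup α) : -g + g = 0 := by
  by_cases h : g.frac = 0
  · have : -g = ⟨-g.int, 0, zero_ne_one⟩ := dif_pos h
    rw [this, add_of_ne (by simpa using g.frac_ne)]
    ext <;> simp [h]
  · have : -g = ⟨-g.int - 1, g.fracᶜ, _⟩ := dif_neg h
    rw [this, add_of_eq (by simp)]
    ext
    · simp only [zero_int]; ring
    · simp

protected theorem add_assoc (a b c : ChangGroup α) : a + b + c = a + (b + c) := by
  obtain ⟨l, x, hx⟩ := a
  obtain ⟨m, y, hy⟩ := b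
  obtain ⟨n, z, hz⟩ := c
  -- The cases record which inner sum carries. If just one does, `mul_add_assoc` shows that the
  -- other bracketing carries in its outer sum instead; if both or neither do, `add_mul_assoc`
  -- compares the fractional parts.
  by_cases h1 : x + y = 1 <;> by_cases h2 : y + z = 1
  · rw [add_of_eq (g := ⟨l, x, hx⟩) h1, add_of_eq (g := ⟨m, y, hy⟩) h2]
    have key : x * y + z = x + y * z := by
      have := add_mul_assoc (x := xᶜ) (y := yᶜ) (z := zᶜ)
        (by rw [← compl_add, h1, compl_one]) (by rw [← compl_add, h2, compl_one])
      rw [← MVAlgebra.compl_injective.eq_iff]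
      rw [compl_add, compl_add, compl_mul, compl_mul, this]
    by_cases h3 : x * y + z = 1
    · rw [add_of_eq h3, add_of_eq (key ▸ h3)]
      ext
      · simp only; ring
      · exact mul_assoc _ _ _
    · rw [add_of_ne h3, add_of_ne (fun h => h3 (key.trans h))]
      ext
      · simp only; ring
      · exact key
  · rw [add_of_eq (g := ⟨l, x, hx⟩) h1, add_of_ne (g := ⟨m, y, hy⟩) h2]
    have key := mul_add_assoc h1 (mul_eq_zero_of h2)
    rw [add_of_ne (key ▸ fun h => h2 (one_le_iff.1 (h ▸ mul_le_right' _ _))),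
      add_of_eq (by simp only; rw [← add_assoc, h1, one_add])]
    ext
    · simp only; ring
    · exact key
  · rw [add_of_ne (g := ⟨l, x, hx⟩) h1, add_of_eq (g := ⟨m, y, hy⟩) h2]
    have key := mul_add_assoc ((add_comm z y).trans h2)
      ((mul_comm y x).trans (mul_eq_zero_of h1))
    rw [add_of_eq (by simp only; rw [add_assoc, h2, add_one]),
      add_of_ne (by
        simp only
        rw [add_comm, mul_comm, key]
        exact mul_ne_one hz)]
    ext
    · simp only; ring
    · simp only
      rw [mul_comm, add_comm x y, ← key, add_comm, mul_comm]
  · rw [add_of_ne (g := ⟨l, x, hx⟩) h1, add_of_ne (g := ⟨m, y, hy⟩) h2]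
    by_cases h3 : x + y + z = 1
    · rw [add_of_eq h3, add_of_eq ((add_assoc x y z).symm.trans h3)]
      ext
      · simp only; ring
      · exact add_mul_assoc (mul_eq_zero_of h1) (mul_eq_zero_of h2)
    · rw [add_of_ne h3, add_of_ne (fun h => h3 ((add_assoc x y z).trans h))]
      ext
      · simp only; ring
      · exact add_assoc _ _ _

noncomputable instance : AddCommGroup (ChangGroup α) where
  add_assoc := ChangGroup.add_assoc
  zero_add := ChangGroup.zero_add
  add_zero g := by rw [ChangGroup.add_comm, ChangGroup.zero_add]
  nsmul := nsmulRec
  zsmul := zsmulRec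
  neg_add_cancel := ChangGroup.neg_add_cancel
  add_comm := ChangGroup.add_comm

variable (α) in
/-- The cone of nonnegative elements. -/
def nonneg : AddSubmonoid (ChangGroup α) where
  carrier := {g | 0 ≤ g.int}
  zero_mem' := le_refl (0 : ℤ)
  add_mem' {g h} (hg : 0 ≤ g.int) (hh : 0 ≤ h.int) := by
    by_cases hs : g.frac + h.frac = 1
    · rw [add_of_eq hs]
      simp only [Set.mem_ofPred_eq]; omega
    · rw [add_of_ne hs]
      simp only [Set.mem_ofPred_eq]; omega

theorem mem_nonneg {g : ChangGroup α} : g ∈ nonneg α ↔ 0 ≤ g.int := Iff.rfl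

theorem nonneg_or_neg (g : ChangGroup α) : g ∈ nonneg α ∨ -g ∈ nonneg α := by
  simp only [mem_nonneg]
  by_cases h : g.frac = 0
  · have : -g = ⟨-g.int, 0, zero_ne_one⟩ := dif_pos h
    rw [this]
    simp only; omega
  · have : -g = ⟨-g.int - 1, g.fracᶜ, _⟩ := dif_neg h
    rw [this]
    simp only; omega

theorem eq_zero_of_nonneg {g : ChangGroup α} (h : g ∈ nonneg α) (h' : -g ∈ nonneg α) :
    g = 0 := by
  simp only [mem_nonneg] at h h'
  by_cases h0 : g.frac = 0
  · have : -g = ⟨-g.int, 0, zero_ne_one⟩ := dif_pos h0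
    rw [this] at h'
    ext
    · simp only [zero_int] at *; omega
    · exact h0
  · have : -g = ⟨-g.int - 1, g.fracᶜ, _⟩ := dif_neg h0
    rw [this] at h'
    simp only at h'
    omega

variable (α) in
/-- The strong unit. -/
def unit : ChangGroup α := ⟨1, 0, zero_ne_one⟩

open Classical in
/-- The embedding of the chain as the unit interval of its group. -/
noncomputable def ofChain (x : α) : ChangGroup α :=
  if h : x = 1 then unit α else ⟨0, x, h⟩

theorem ofChain_one : ofChain (1 : α) = unit α := dif_pos rfl

theorem ofChain_of_ne {x : α} (h : x ≠ 1) : ofChain x = ⟨0, x, h⟩ := dif_neg h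

theorem ofChain_zero : ofChain (0 : α) = 0 := ofChain_of_ne MVChain.zero_ne_one

theorem ofChain_nonneg (x : α) : ofChain x ∈ nonneg α := by
  by_cases h : x = 1
  · subst h
    rw [ofChain_one]
    exact zero_le_one (α := ℤ)
  · rw [ofChain_of_ne h]
    exact le_refl (0 : ℤ)

theorem ofChain_injective : Function.Injective (ofChain : α → ChangGroup α) := by
  intro x y h
  by_cases hx : x = 1 <;> by_cases hy : y = 1
  · rw [hx, hy]
  · subst hx
    rw [ofChain_one, ofChain_of_ne hy] at h
    cases congrArg int h
  · subst hy
    rw [ofChain_one, ofChain_of_ne hx] at h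
    cases congrArg int h
  · rw [ofChain_of_ne hx, ofChain_of_ne hy] at h
    exact congrArg frac h

/-- Truncated sum and product together keep the whole sum; the rules for complements, order and
carries below all follow from this. -/
theorem ofChain_add (x y : α) : ofChain x + ofChain y = ofChain (x + y) + ofChain (x * y) := by
  by_cases hx : x = 1
  · subst hx; rw [one_add, one_mul]
  by_cases hy : y = 1
  · subst hy; rw [add_one, mul_one, add_comm]
  rw [ofChain_of_ne hx, ofChain_of_ne hy]
  by_cases hs : x + y = 1
  · rw [add_of_eq hs, hs, ofChain_one, ofChain_of_ne (mul_ne_one hx), unit,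
      add_of_ne (by simpa using mul_ne_one hx)]
    ext <;> simp
  · rw [add_of_ne hs, mul_eq_zero_of hs, ofChain_zero, add_zero, ofChain_of_ne hs]
    ext <;> simp

theorem ofChain_compl (x : α) : ofChain xᶜ = unit α - ofChain x := by
  rw [eq_sub_iff_add_eq, ofChain_add, compl_add_self, compl_mul_self, ofChain_one, ofChain_zero,
    add_zero]

theorem ofChain_add_of_eq {x y : α} (h : x + y = 1) :
    ofChain x + ofChain y - unit α ∈ nonneg α := by
  rw [ofChain_add, h, ofChain_one, add_sub_cancel_left]
  exact ofChain_nonneg _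

theorem ofChain_add_of_ne {x y : α} (h : x + y ≠ 1) :
    ofChain (x + y) = ofChain x + ofChain y := by
  rw [ofChain_add, mul_eq_zero_of h, ofChain_zero, add_zero]

theorem ofChain_sub_of_le {x y : α} (h : x ≤ y) : ofChain y - ofChain x ∈ nonneg α := by
  have := ofChain_add_of_eq (le_def.1 h)
  rw [ofChain_compl] at this
  rwa [show unit α - ofChain x + ofChain y - unit α = ofChain y - ofChain x by abel] at this

theorem unit_ne_zero : unit α ≠ 0 := fun h => by cases congrArg int h

theorem unit_nonneg : unit α ∈ nonneg α := zero_le_one (α := ℤ)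

variable {β : Type*} [MVChain β]

/-- The homomorphism of groups that is induced by an embedding of chains. -/
noncomputable def map (f : α → β) (hf : Function.Injective f) (hadd : ∀ x y, f (x + y) = f x + f y)
    (hcompl : ∀ x, f xᶜ = (f x)ᶜ) (h0 : f 0 = 0) : ChangGroup α →+ ChangGroup β :=
  have h1 : f 1 = 1 := by rw [one_def, hcompl, h0]; rfl
  AddMonoidHom.mk' (fun g => ⟨g.int, f g.frac, fun h => g.frac_ne (hf (h.trans h1.symm))⟩) (by
    intro g h
    by_cases hs : g.frac + h.frac = 1
    · rw [add_of_eq hs, add_of_eq (by simp only; rw [← hadd, hs, h1])]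
      ext
      · rfl
      · simp only [mul_def, hcompl, hadd]
    · rw [add_of_ne hs, add_of_ne (by
        simp only
        rw [← hadd, ← h1]
        exact fun h => hs (hf h))]
      ext
      · rfl
      · exact hadd _ _)

section

variable {f : α → β} {hf : Function.Injective f} {hadd : ∀ x y, f (x + y) = f x + f y}
  {hcompl : ∀ x, f xᶜ = (f x)ᶜ} {h0 : f 0 = 0}

theorem map_nonneg {g : ChangGroup α} : map f hf hadd hcompl h0 g ∈ nonneg β ↔ g ∈ nonneg α :=
  Iff.rfl

theorem map_unit : map f hf hadd hcompl h0 (unit α) = unit β := by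
  ext
  · rfl
  · exact h0

theorem map_ofChain (x : α) : map f hf hadd hcompl h0 (ofChain x) = ofChain (f x) := by
  have h1 : f 1 = 1 := by rw [one_def, hcompl, h0]; rfl
  by_cases hx : x = 1
  · subst hx
    rw [h1, ofChain_one, ofChain_one, map_unit]
  · rw [ofChain_of_ne hx, ofChain_of_ne (fun h => hx (hf (h.trans h1.symm)))]
    rfl

end

end ChangGroup

/-! ### Positive homomorphisms to the rationals -/

/-- An element of infinite order spans a copy of `ℤ`, whose embedding in `ℚ` extends because `ℚ` is
divisible, hence injective. -/
theorem exists_addMonoidHom_rat_pos {W : Type*} [AddCommGroup W] (w : W)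
    (hw : ∀ n : ℕ, n • w = 0 → n = 0) : ∃ f : W →+ ℚ, 0 < f w := by
  have hinj : Function.Injective (zmultiplesHom W w) := by
    rw [injective_iff_map_eq_zero]
    intro n hn
    have h2 : n.natAbs • w = 0 := by
      rcases Int.natAbs_eq n with h | h
      · rw [h] at hn
        simpa using hn
      · rw [h] at hn
        simpa using hn
    exact Int.natAbs_eq_zero.1 (hw _ h2)
  obtain ⟨f, hf⟩ := (Module.Baer.of_divisible (A := ℚ)).extension_property_addMonoidHom
    (zmultiplesHom W w) hinj (Int.castAddHom ℚ)
  refine ⟨f, ?_⟩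
  have := DFunLike.congr_fun hf 1
  simp at this
  simp [this]

/-- Gordan's theorem for abelian groups. -/
theorem exists_addMonoidHom_pos {ι : Type*} (s : Finset ι) :
    ∀ (W : Type u) [AddCommGroup W] (p : ι → W),
      (∀ n : ι → ℕ, ∑ i ∈ s, n i • p i = 0 → ∀ i ∈ s, n i = 0) →
      ∃ f : W →+ ℚ, ∀ i ∈ s, 0 < f (p i) := by
  classical
  induction s using Finset.induction_on with
  | empty => exact fun W _ p _ => ⟨0, by simp⟩
  | insert a s ha ih =>
    intro W _ p hp
    have hcons : ∀ (m : ℕ) (n : ι → ℕ), m • p a + ∑ i ∈ s, n i • p i = 0 →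
        m = 0 ∧ ∀ i ∈ s, n i = 0 := by
      intro m n h
      have hne : ∀ i ∈ s, i ≠ a := fun i hi h => ha (h ▸ hi)
      have := hp (fun i => if i = a then m else n i) (by
        rw [Finset.sum_insert ha, if_pos rfl, ← h]
        congr 1
        exact Finset.sum_congr rfl fun i hi => by rw [if_neg (hne i hi)])
      refine ⟨by simpa using this a (Finset.mem_insert_self _ _), fun i hi => ?_⟩
      simpa [hne i hi] using this i (Finset.mem_insert_of_mem hi)
    -- Pass to the quotient by `p a`. If the other `p i` have no nonnegative relation there, a
    -- homomorphism positive on them pulls back to one that vanishes at `p a`; a large multiple of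
    -- it is added to one positive at `p a`.
    by_cases hq : ∀ n : ι → ℕ,
        ∑ i ∈ s, n i • (QuotientAddGroup.mk' (AddSubgroup.zmultiples (p a)) (p i)) = 0 →
        ∀ i ∈ s, n i = 0
    · obtain ⟨f, hf⟩ := ih _ _ hq
      obtain ⟨g, hg⟩ := exists_addMonoidHom_rat_pos (p a) fun m hm =>
        (hcons m (fun _ => 0) (by simpa using hm)).1
      set f' := f.comp (QuotientAddGroup.mk' (AddSubgroup.zmultiples (p a))) with hf'
      have hfa : f' (p a) = 0 := by
        have : (QuotientAddGroup.mk' (AddSubgroup.zmultiples (p a))) (p a) = 0 := by simp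
        rw [hf', AddMonoidHom.comp_apply, this, map_zero]
      obtain ⟨N, hN⟩ : ∃ N : ℕ, ∀ i ∈ s, -g (p i) / f' (p i) < N := by
        obtain ⟨M, hM⟩ := (s.image fun i => -g (p i) / f' (p i)).bddAbove
        obtain ⟨N, hN⟩ := exists_nat_gt M
        exact ⟨N, fun i hi => (hM (by
          exact Finset.mem_coe.2 (Finset.mem_image_of_mem _ hi))).trans_lt hN⟩
      refine ⟨N • f' + g, fun i hi => ?_⟩
      rcases Finset.mem_insert.1 hi with rfl | hi
      · simp [hfa, hg]
      · have h1 := hN i hi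
        rw [div_lt_iff₀ (show 0 < f' (p i) from hf i hi)] at h1
        simp only [AddMonoidHom.add_apply, AddMonoidHom.nsmul_apply, nsmul_eq_mul]
        linarith
    -- Otherwise a nontrivial nonnegative combination of the other `p i` equals `z • p a`.
    -- Independence forces `z > 0`, so positivity on the other `p i` implies positivity at `p a`.
    · push Not at hq
      obtain ⟨n, hn, j, hj, hnj⟩ := hq
      obtain ⟨f, hf⟩ := ih W p fun n' h' => (hcons 0 n' (by simpa using h')).2
      refine ⟨f, fun i hi => ?_⟩
      rcases Finset.mem_insert.1 hi with rfl | hi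
      · have hmem : ∑ l ∈ s, n l • p l ∈ AddSubgroup.zmultiples (p i) := by
          rw [← QuotientAddGroup.eq_zero_iff, ← hn]
          simp
        obtain ⟨z, hz⟩ := AddSubgroup.mem_zmultiples_iff.1 hmem
        have hzpos : 0 < z := by
          by_contra hz0
          obtain ⟨m, hm⟩ := Int.eq_ofNat_of_zero_le (a := -z) (by omega)
          refine hnj ((hcons m n ?_).2 j hj)
          rw [← hz, ← natCast_zsmul, ← hm]
          simp
        have hsum : (z : ℚ) * f (p i) = ∑ l ∈ s, (n l : ℚ) * f (p l) := by
          have := congrArg f hz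
          simpa [map_sum] using this
        have hpos : 0 < ∑ l ∈ s, (n l : ℚ) * f (p l) :=
          Finset.sum_pos' (fun l hl => mul_nonneg (Nat.cast_nonneg _) (hf l hl).le)
            ⟨j, hj, mul_pos (by exact_mod_cast Nat.pos_of_ne_zero hnj) (hf j hj)⟩
        rw [← hsum] at hpos
        exact pos_of_mul_pos_right hpos (by exact_mod_cast hzpos.le)
      · exact hf i hi

theorem AddSubmonoid.eq_zero_of_sum_eq_zero {G ι : Type*} [AddCommGroup G] (P : AddSubmonoid G)
    (hP : ∀ g ∈ P, -g ∈ P → g = 0) (s : Finset ι) (g : ι → G) (hg : ∀ i ∈ s, g i ∈ P)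
    (hsum : ∑ i ∈ s, g i = 0) : ∀ i ∈ s, g i = 0 := by
  classical
  intro i hi
  refine hP _ (hg i hi) ?_
  rw [← Finset.add_sum_erase s g hi] at hsum
  rw [neg_eq_of_add_eq_zero_right hsum]
  exact P.sum_mem fun j hj => hg j (Finset.mem_of_mem_erase hj)

/-- Finite parts of partially ordered groups `G i` with a common subgroup `H` can be mapped
compatibly to `ℚ`. -/
theorem exists_compatible_pos {ι : Type} [Fintype ι] (G : ι → Type u) [∀ i, AddCommGroup (G i)]
    (P : ∀ i, AddSubmonoid (G i)) (hP : ∀ i, ∀ g ∈ P i, -g ∈ P i → g = 0)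
    {H : Type u} [AddCommGroup H] (PH : AddSubmonoid H) (hPH : ∀ g ∈ PH, -g ∈ PH → g = 0)
    (f : ∀ i, H →+ G i) (hf : ∀ i h, f i h ∈ P i → h ∈ PH) (F : ∀ i, Set (G i))
    (hF : ∀ i, (F i).Finite) :
    ∃ φ : ∀ i, G i →+ ℚ, (∀ i j h, φ i (f i h) = φ j (f j h)) ∧
      ∀ i, ∀ g ∈ F i, g ∈ P i → g ≠ 0 → 0 < φ i g := by
  classical
  -- `K` consists of the tuples with sum zero and `N` of their images, so the quotient by `N` is the
  -- amalgam in which the copies of `H` are identified.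
  let K : AddSubgroup (ι → H) := (∑ i, Pi.evalAddMonoidHom (fun _ : ι => H) i).ker
  let N : AddSubgroup (∀ i, G i) :=
    K.map (AddMonoidHom.mk' (fun h i => f i (h i)) fun a b => by ext; simp)
  let T : Set (Σ i, G i) := {x | x.2 ∈ F x.1 ∧ x.2 ∈ P x.1 ∧ x.2 ≠ 0}
  have hT : T.Finite := by
    refine Set.Finite.subset (Set.finite_iUnion fun i => (hF i).image (Sigma.mk i)) ?_
    rintro ⟨i, g⟩ h
    exact Set.mem_iUnion.2 ⟨i, g, h.1, rfl⟩
  obtain ⟨φ, hφ⟩ := exists_addMonoidHom_pos hT.toFinset ((∀ i, G i) ⧸ N)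
    (fun x => QuotientAddGroup.mk' N (Pi.single x.1 x.2)) (by
      intro n hn
      have hmem : ∑ x ∈ hT.toFinset, n x • (Pi.single x.1 x.2 : ∀ i, G i) ∈ N := by
        rw [← QuotientAddGroup.eq_zero_iff, ← hn]
        simp
      obtain ⟨h, hK, hh⟩ := hmem
      have hcomp : ∀ i, f i (h i) = ∑ x ∈ hT.toFinset with x.1 = i,
          n x • (Pi.single x.1 x.2 : ∀ i, G i) i := by
        intro i
        rw [Finset.sum_filter]
        have := congrFun hh i
        simp only [AddMonoidHom.mk'_apply, Finset.sum_apply, Pi.smul_apply] at this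
        rw [this]
        refine Finset.sum_congr rfl fun x _ => ?_
        split_ifs with hx
        · rfl
        · rw [Pi.single_eq_of_ne (Ne.symm hx), smul_zero]
      have hterm : ∀ i, ∀ x ∈ hT.toFinset.filter (·.1 = i),
          n x • (Pi.single x.1 x.2 : ∀ i, G i) i ∈ P i := by
        intro i x hx
        obtain ⟨hx', rfl⟩ := Finset.mem_filter.1 hx
        rw [Pi.single_eq_same]
        exact nsmul_mem ((hT.mem_toFinset.1 hx').2.1) _
      -- Each `f i (h i)` is a sum of elements of `P i`, so `h i` is in the cone `PH`; since the `h
      -- i` sum to zero, all vanish. Then the terms in each component sum to zero, and so vanish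
      -- too.
      have hh0 : ∀ i ∈ Finset.univ, h i = 0 := by
        refine PH.eq_zero_of_sum_eq_zero hPH _ h (fun i _ => hf i _ ?_) ?_
        · rw [hcomp]
          exact sum_mem (hterm i)
        · have : (∑ i, Pi.evalAddMonoidHom (fun _ : ι => H) i) h = 0 := hK
          simpa using this
      intro x hx
      have h0 := (P x.1).eq_zero_of_sum_eq_zero (hP x.1) _ _ (hterm x.1)
        (by rw [← hcomp, hh0 _ (Finset.mem_univ _), map_zero]) x
        (Finset.mem_filter.2 ⟨hx, rfl⟩)
      rw [Pi.single_eq_same] at h0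
      by_contra hnx
      obtain ⟨m, hm⟩ := Nat.exists_eq_succ_of_ne_zero hnx
      obtain ⟨-, hxP, hx0⟩ := hT.mem_toFinset.1 hx
      refine hx0 (hP _ _ hxP ?_)
      rw [hm, succ_nsmul] at h0
      rw [neg_eq_of_add_eq_zero_left h0]
      exact nsmul_mem hxP _)
  refine ⟨fun i => (φ.comp (QuotientAddGroup.mk' N)).comp (AddMonoidHom.single G i), ?_, ?_⟩
  · intro i j h
    simp only [AddMonoidHom.comp_apply, AddMonoidHom.single_apply]
    congr 1
    rw [← sub_eq_zero, ← map_sub]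
    refine (QuotientAddGroup.eq_zero_iff _).2 ⟨Pi.single i h - Pi.single j h, ?_, ?_⟩
    · change (∑ i, Pi.evalAddMonoidHom (fun _ : ι => H) i) _ = 0
      simp
    · ext l
      have key : ∀ m, f l ((Pi.single m h : ι → H) l) = (Pi.single m (f m h) : ∀ i, G i) l := by
        intro m
        by_cases hm : l = m
        · subst hm; simp
        · simp [Pi.single_eq_of_ne hm]
      simp [key]
  · intro i g hg hgP hg0
    exact hφ ⟨i, g⟩ (hT.mem_toFinset.2 ⟨hg, hgP, hg0⟩)

/-! ### Prime filters from Zorn's lemma -/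

namespace MVFilter

open MVAlgebra

variable {α : Type*} [MVAlgebra α] {F : MVFilter α}

instance (priority := 100) : OrderBot α where
  bot := 0
  bot_le := MVAlgebra.zero_le'

/-- The filters that are disjoint from a set. -/
def Avoids (D : Set α) (P : MVFilter α) : Prop := ∀ x ∈ P, x ∉ D

/-- If `a ⊔ b ∈ P` but `b ∉ P`, then `P.residual a` is strictly larger than `P`, so `c ⊔ a ∈ P` for
some `c ∈ D`. If also `a ∉ P`, the same argument for `c` and `a` gives `c' ⊔ c ∈ P` with `c' ∈ D`,
against closure of `D` under joins. -/
theorem isPrime_of_maximal {D : Set α} (hD : D.Nonempty) (hsup : ∀ x ∈ D, ∀ y ∈ D, x ⊔ y ∈ D)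
    {P : MVFilter α} (hP : Maximal (Avoids D) P) : P.IsPrime := by
  have hmax : ∀ {a b : α}, a ⊔ b ∈ P → b ∉ P → ∃ c ∈ D, c ⊔ a ∈ P := by
    intro a b hab hb
    by_contra! hc
    refine hb (hP.2 (y := P.residual a) (fun x hx hxD => hc x hxD hx) (le_residual a) ?_)
    rwa [mem_residual, sup_comm]
  refine isPrime_of_sup (fun h0 => ?_) fun a b hab => ?_
  · obtain ⟨d, hd⟩ := hD
    exact hP.1 d (mem_of_le h0 (zero_le' d)) hd
  · by_contra! hnot
    obtain ⟨c, hcD, hca⟩ := hmax hab hnot.2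
    obtain ⟨c', hcD', hcc⟩ := hmax hca hnot.1
    exact hP.1 _ hcc (hsup _ hcD' _ hcD)

theorem exists_maximal_avoids {D : Set α} (hF : Avoids D F) :
    ∃ P, F ≤ P ∧ Maximal (Avoids D) P := by
  refine zorn_le_nonempty₀ {P | Avoids D P} ?_ F hF
  intro c hc hchain y hy
  have hU : ∀ {x}, x ∈ ⋃ P ∈ c, (P : Set α) ↔ ∃ P ∈ c, x ∈ P := by simp
  refine ⟨⟨⋃ P ∈ c, (P : Set α), hU.2 ⟨y, hy, y.one_mem⟩, ?_⟩, ?_, ?_⟩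
  · intro a b ha hab
    obtain ⟨P, hP, ha⟩ := hU.1 ha
    obtain ⟨R, hR, hab⟩ := hU.1 hab
    rcases hchain.total hP hR with h | h
    · exact hU.2 ⟨R, hR, R.mp' (h ha) hab⟩
    · exact hU.2 ⟨P, hP, P.mp' ha (h hab)⟩
  · intro x hx
    obtain ⟨P, hP, hx⟩ := hU.1 hx
    exact hc hP x hx
  · intro P hP x hx
    exact hU.2 ⟨P, hP, hx⟩

theorem exists_isPrime_notMem {d : α} (hd : d ≠ 1) : ∃ P : MVFilter α, P.IsPrime ∧ d ∉ P := by
  have h1 : Avoids {d} (mk' ({1} : Set α) rfl (by rintro x y rfl rfl; exact one_mul 1)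
      (by rintro x y rfl h; exact one_le_iff.1 h)) := by
    intro x (hx : x = 1) hxd
    exact hd ((Set.mem_singleton_iff.1 hxd).symm.trans hx)
  obtain ⟨P, -, hP⟩ := exists_maximal_avoids h1
  refine ⟨P, isPrime_of_maximal (D := {d}) ⟨d, Set.mem_singleton d⟩ ?_ hP, fun h => hP.1 d h rfl⟩
  rintro x rfl y rfl
  simp

theorem IsPrime.finset_sup_notMem [hF : F.IsPrime] {ι : Type*} (s : Finset ι) (x : ι → α)
    (hx : ∀ i ∈ s, x i ∉ F) : s.sup x ∉ F := by
  classical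
  induction s using Finset.induction_on with
  | empty => exact hF.zero_notMem
  | insert a s ha ih =>
    rw [Finset.sup_insert]
    intro h
    rcases hF.mem_or_mem h with h | h
    · exact hx a (Finset.mem_insert_self _ _) h
    · exact ih (fun i hi => hx i (Finset.mem_insert_of_mem hi)) h

/-- Incomparable prime filters are separated by pairwise orthogonal elements. -/
theorem exists_orthogonal {ι : Type*} [Fintype ι] (P : ι → MVFilter α) [hP : ∀ i, (P i).IsPrime]
    (h : ∀ i j, i ≠ j → ¬ P i ≤ P j) :
    ∃ x : ι → α, (∀ i, x i ∉ P i) ∧ ∀ i j, i ≠ j → x i ⊔ x j = 1 := by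
  classical
  have h' : ∀ i j, ∃ a : α, i ≠ j → a ∈ P i ∧ a ∉ P j := by
    intro i j
    by_cases hij : i = j
    · exact ⟨0, fun hne => absurd hij hne⟩
    · obtain ⟨a, ha⟩ := SetLike.not_le_iff_exists.1 (h i j hij)
      exact ⟨a, fun _ => ha⟩
  choose a ha using h'
  have hle : ∀ i j, i ≠ j → (a i j)ᶜ + a j i ≤
      (Finset.univ.erase i).sup fun j => (a i j)ᶜ + a j i := fun i j hij =>
    Finset.le_sup (f := fun j => (a i j)ᶜ + a j i)
      (Finset.mem_erase.2 ⟨hij.symm, Finset.mem_univ _⟩)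
  -- Since `a i j ∈ P i` and `a j i ∉ P i`, the implication from the first to the second is outside
  -- `P i`, and by primeness so is the join over `j`. Orthogonality is prelinearity.
  refine ⟨fun i => (Finset.univ.erase i).sup fun j => (a i j)ᶜ + a j i, fun i => ?_,
    fun i j hij => ?_⟩
  · refine (hP i).finset_sup_notMem _ _ fun j hj hmem => ?_
    have hij := (Finset.mem_erase.1 hj).1
    exact (ha j i hij).2 ((P i).mp' (ha i j hij.symm).1 hmem)
  · rw [← one_le_iff, ← prelinear (a i j) (a j i)]
    exact sup_le_sup (hle i j hij) (hle j i hij.symm)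

end MVFilter

/-! ### Universal quantifiers and their prime filters -/

/-- A universal quantifier on an MV-algebra. -/
structure IsQuantifier {α : Type*} [MVAlgebra α] (Q : α → α) : Prop where
  le : ∀ x, Q x ≤ x
  imp : ∀ x y, Q ((Q x)ᶜ + y) = (Q x)ᶜ + Q y
  sup : ∀ x y, Q (Q x ⊔ y) = Q x ⊔ Q y
  add_self : ∀ x, Q (x + x) = Q x + Q x

namespace IsQuantifier

open MVAlgebra

variable {α : Type*} [MVAlgebra α] {Q : α → α} (hQ : IsQuantifier Q)

include hQ

theorem zero : Q 0 = 0 := le_zero_iff'.1 (hQ.le 0)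

theorem one : Q 1 = 1 := by
  have := hQ.imp 1 1
  rwa [add_one, compl_add_self] at this

theorem le_apply {x y : α} (h : Q x ≤ y) : Q x ≤ Q y := by
  rw [le_def] at h ⊢
  rw [← hQ.imp, h, hQ.one]

theorem mono {x y : α} (h : x ≤ y) : Q x ≤ Q y := hQ.le_apply ((hQ.le x).trans h)

theorem idem (x : α) : Q (Q x) = Q x := le_antisymm (hQ.le _) (hQ.le_apply le_rfl)

theorem compl {x : α} (hx : Q x = x) : Q xᶜ = xᶜ := by
  have := hQ.imp x 0
  rwa [hx, hQ.zero, add_zero] at this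

theorem add_left {x : α} (hx : Q x = x) (y : α) : Q (x + y) = x + Q y := by
  have := hQ.imp xᶜ y
  rwa [hQ.compl hx, cc] at this

theorem add {x y : α} (hx : Q x = x) (hy : Q y = y) : Q (x + y) = x + y := by
  rw [hQ.add_left hx, hy]

theorem sup_left {x : α} (hx : Q x = x) (y : α) : Q (x ⊔ y) = x ⊔ Q y := by
  have := hQ.sup x y
  rwa [hx] at this

theorem sup_fixed {x y : α} (hx : Q x = x) (hy : Q y = y) : Q (x ⊔ y) = x ⊔ y := by
  rw [hQ.sup_left hx, hy]

theorem mul {x y : α} (hx : Q x = x) (hy : Q y = y) : Q (x * y) = x * y :=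
  hQ.compl (hQ.add (hQ.compl hx) (hQ.compl hy))

/-- Adding `cᶜ` is injective below `c` and turns `c * z` into `z ⊔ cᶜ`; `Q` commutes with joins with
fixed elements. -/
theorem mul_left {c : α} (hc : Q c = c) (x : α) : Q (c * x) = c * Q x := by
  have hsup : ∀ z : α, cᶜ + c * z = z ⊔ cᶜ := fun z => by
    rw [sup_def, mul_comm, mul_def, add_comm]
  have h1 : cᶜ + Q (c * x) = cᶜ + c * Q x := by
    rw [← hQ.add_left (hQ.compl hc), hsup, hsup, sup_comm, hQ.sup_left (hQ.compl hc), sup_comm]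
  have hcancel : ∀ {u : α}, u ≤ c → c * (cᶜ + u) = u := fun {u} hu => by
    rw [mul_imp, inf_eq_right.2 hu]
  rw [← hcancel ((hQ.le _).trans (mul_le_left' c x)), h1, hcancel (mul_le_left' _ _)]

theorem compl_imp (a : α) : Q (aᶜ + Q a)ᶜ = 0 := by
  rw [compl_add, cc, mul_comm, hQ.mul_left (hQ.compl (hQ.idem a)), compl_mul_self]

/-- Squaring an element doubles its complement, so `add_self`, that is `∃(x * x) = ∃x * ∃x`, settles
the exponents `2 ^ m`; `e ^ n` lies above `e ^ 2 ^ n`. -/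
theorem compl_pow {e : α} (he : Q eᶜ = 0) (n : ℕ) : Q (e ^ n)ᶜ = 0 := by
  have h2 : ∀ m : ℕ, Q (e ^ 2 ^ m)ᶜ = 0 := by
    intro m
    induction m with
    | zero => simpa using he
    | succ m ih =>
      rw [pow_succ, pow_mul, sq, compl_mul, hQ.add_self, ih, add_zero]
  rw [← le_zero_iff', ← h2 n]
  refine hQ.mono (compl_le_compl ?_)
  obtain ⟨m, hm⟩ := Nat.exists_eq_add_of_le (Nat.lt_two_pow_self (n := n)).le
  rw [hm, pow_add]
  exact mul_le_left' _ _

variable {P₀ : MVFilter α}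

/-- Zorn's lemma starts from the filter generated by the fixed elements of `P₀` and `e`. If `q * e ^
n ≤ c` with `q`, `c` fixed, then `(qᶜ + c)ᶜ ≤ (e ^ n)ᶜ`; applying `Q` gives `q ≤ c`, so `c ∈ P₀`
whenever `q ∈ P₀`. -/
theorem exists_maximal_avoids (a : α) : ∃ P : MVFilter α,
    Maximal (MVFilter.Avoids {c | Q c = c ∧ c ∉ P₀}) P ∧ (∀ c, Q c = c → c ∈ P₀ → c ∈ P) ∧
      aᶜ + Q a ∈ P := by
  set e := aᶜ + Q a with he
  let F : MVFilter α := .mk' {z | ∃ q, Q q = q ∧ q ∈ P₀ ∧ ∃ n : ℕ, q * e ^ n ≤ z}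
    ⟨1, hQ.one, P₀.one_mem, 0, by simp⟩
    (by
      rintro x y ⟨q, hq, hqP, n, hx⟩ ⟨r, hr, hrP, m, hy⟩
      refine ⟨q * r, hQ.mul hq hr, MVFilter.mul_mem hqP hrP, n + m, ?_⟩
      rw [pow_add, mul_mul_mul_comm]
      exact mul_le_mul' hx hy)
    (by
      rintro x y ⟨q, hq, hqP, n, hx⟩ hxy
      exact ⟨q, hq, hqP, n, hx.trans hxy⟩)
  have hF : MVFilter.Avoids {c | Q c = c ∧ c ∉ P₀} F := by
    rintro c ⟨q, hq, hqP, n, hc⟩ ⟨hc1, hc2⟩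
    rw [mul_comm, mul_le_iff, ← compl_le_iff] at hc
    have h1 := hQ.mono hc
    rw [hQ.compl_pow (hQ.compl_imp a), hQ.compl (hQ.add (hQ.compl hq) hc1), le_zero_iff',
      ← MVAlgebra.compl_injective.eq_iff, cc, compl_zero] at h1
    exact hc2 (MVFilter.mem_of_le hqP h1)
  obtain ⟨P, hFP, hP⟩ := MVFilter.exists_maximal_avoids hF
  refine ⟨P, hP, fun c hc hcP => hFP ?_, hFP ?_⟩
  · exact ⟨c, hc, hcP, 0, by simp⟩
  · exact ⟨1, hQ.one, P₀.one_mem, 1, by simp⟩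

/-- If there are at most `k` pairwise orthogonal elements, then finitely many prime filters
suffice to compute the quantifier. -/
theorem exists_primes {k : ℕ} [hP₀ : P₀.IsPrime]
    (hW : ∀ x : Fin (k + 1) → α, (∀ i j, i ≠ j → x i ⊔ x j = 1) → ∃ i, Q (x i) ∈ P₀) :
    ∃ P : Fin k → MVFilter α, (∀ i, (P i).IsPrime) ∧
      (∀ i c, Q c = c → (c ∈ P i ↔ c ∈ P₀)) ∧ ∀ a, ∃ i, aᶜ + Q a ∈ P i := by
  let D : Set α := {c | Q c = c ∧ c ∉ P₀}
  let X : Set (MVFilter α) :=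
    {P | Maximal (MVFilter.Avoids D) P ∧ ∀ c, Q c = c → c ∈ P₀ → c ∈ P}
  have hprime : ∀ P ∈ X, P.IsPrime := by
    intro P hP
    refine MVFilter.isPrime_of_maximal (D := D) ⟨0, hQ.zero, hP₀.zero_notMem⟩ ?_ hP.1
    rintro x ⟨hx, hx'⟩ y ⟨hy, hy'⟩
    refine ⟨hQ.sup_fixed hx hy, fun h => ?_⟩
    rcases hP₀.mem_or_mem h with h | h
    · exact hx' h
    · exact hy' h
  -- Distinct members of `X` are incomparable by maximality. For orthogonal `x i` outside them, `hW`
  -- puts some `Q (x i)` in `P₀`, hence `x i` in its own filter.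
  have hcard : ¬ ∃ f : Fin (k + 1) → X, Function.Injective f := by
    rintro ⟨f, hf⟩
    have : ∀ i, (f i : MVFilter α).IsPrime := fun i => hprime _ (f i).2
    obtain ⟨x, hx, hx1⟩ := MVFilter.exists_orthogonal (fun i => (f i : MVFilter α))
      fun i j hij hle => hij (hf (Subtype.ext
        (le_antisymm hle ((f i).2.1.2 (f j).2.1.1 hle))))
    obtain ⟨i, hi⟩ := hW x hx1
    exact hx i (MVFilter.mem_of_le ((f i).2.2 _ (hQ.idem _) hi) (hQ.le _))
  -- `X` may have fewer than `k` members, so the enumeration may repeat; this needs `X` nonempty.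
  have hX : ∃ P : Fin k → X, Function.Surjective P := by
    have hne : Nonempty X := by
      obtain ⟨P, h1, h2, -⟩ := hQ.exists_maximal_avoids (P₀ := P₀) 0
      exact ⟨⟨P, h1, h2⟩⟩
    have hfin : Finite X := by
      by_contra hinf
      rw [not_finite_iff_infinite] at hinf
      exact hcard ⟨fun i => Infinite.natEmbedding X i, fun i j h =>
        Fin.ext ((Infinite.natEmbedding X).injective h)⟩
    have := Fintype.ofFinite X
    have hle : Fintype.card X ≤ k := by
      by_contra! hlt
      obtain ⟨f⟩ := Function.Embedding.nonempty_of_card_le (α := Fin (k + 1)) (β := X)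
        (by simpa using hlt)
      exact hcard ⟨f, f.injective⟩
    obtain ⟨f⟩ := Function.Embedding.nonempty_of_card_le (α := X) (β := Fin k) (by simpa using hle)
    exact ⟨Function.invFun f, Function.invFun_surjective f.injective⟩
  obtain ⟨P, hP⟩ := hX
  refine ⟨fun i => P i, fun i => hprime _ (P i).2, fun i c hc => ⟨fun h => ?_, (P i).2.2 c hc⟩,
    fun a => ?_⟩
  · by_contra hc'
    exact (P i).2.1.1 c h ⟨hc, hc'⟩
  · obtain ⟨R, h1, h2, h3⟩ := hQ.exists_maximal_avoids (P₀ := P₀) a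
    obtain ⟨i, hi⟩ := hP ⟨R, h1, h2⟩
    exact ⟨i, by simp only [hi]; exact h3⟩

end IsQuantifier

/-! ### Fixed elements and the partial embedding -/

namespace IsQuantifier

open MVAlgebra

variable {α : Type*} [MVAlgebra α] {Q : α → α} {P₀ : MVFilter α} (hQ : IsQuantifier Q)

/-- The subalgebra of fixed elements. -/
def Fixed (_ : IsQuantifier Q) : Type _ := {x : α // Q x = x}

instance : Add hQ.Fixed := ⟨fun x y => ⟨x.1 + y.1, hQ.add x.2 y.2⟩⟩

instance : Zero hQ.Fixed := ⟨⟨0, hQ.zero⟩⟩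

instance : Compl hQ.Fixed := ⟨fun x => ⟨x.1ᶜ, hQ.compl x.2⟩⟩

instance : MVAlgebra hQ.Fixed where
  nsmul := nsmulRec
  add_assoc _ _ _ := Subtype.ext (add_assoc _ _ _)
  zero_add _ := Subtype.ext (zero_add _)
  add_zero _ := Subtype.ext (add_zero _)
  add_comm _ _ := Subtype.ext (add_comm _ _)
  compl_compl' _ := Subtype.ext (cc _)
  add_compl_zero _ := Subtype.ext (add_one _)
  luk _ _ := Subtype.ext (luk _ _)

/-- The restriction of a filter to the subalgebra of fixed elements. -/
def restrict (P : MVFilter α) : MVFilter hQ.Fixed where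
  carrier := {x | x.1 ∈ P}
  one_mem := P.one_mem
  mp h h' := P.mp' h h'

instance (P : MVFilter α) [hP : P.IsPrime] : (hQ.restrict P).IsPrime where
  zero_notMem := hP.zero_notMem
  imp_mem x y := hP.imp_mem x.1 y.1

/-- The comparison map between quotients. -/
def toQuot {P : MVFilter α} (h : ∀ c, Q c = c → (c ∈ P ↔ c ∈ P₀)) :
    (hQ.restrict P₀).Quot → P.Quot :=
  Quotient.map Subtype.val fun x y hxy =>
    ⟨(h _ (hQ.add (hQ.compl x.2) y.2)).2 hxy.1, (h _ (hQ.add (hQ.compl y.2) x.2)).2 hxy.2⟩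

theorem toQuot_injective {P : MVFilter α} (h : ∀ c, Q c = c → (c ∈ P ↔ c ∈ P₀)) :
    Function.Injective (hQ.toQuot h) := by
  rintro ⟨x⟩ ⟨y⟩ hxy
  have := MVFilter.proj_eq_iff.1 hxy
  exact MVFilter.proj_eq_iff.2
    ⟨(h _ (hQ.add (hQ.compl x.2) y.2)).1 this.1, (h _ (hQ.add (hQ.compl y.2) x.2)).1 this.2⟩

end IsQuantifier

open MVAlgebra ChangGroup in
/-- Finite parts of an MV-algebra with a universal quantifier of finite width embed in a power of
the unit interval, with the minimum as quantifier. -/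
theorem IsQuantifier.exists_partial_embedding {α : Type u} [MVAlgebra α] {Q : α → α}
    (hQ : IsQuantifier Q) {k : ℕ} {P₀ : MVFilter α} [hP₀ : P₀.IsPrime]
    (hW : ∀ x : Fin (k + 1) → α, (∀ i j, i ≠ j → x i ⊔ x j = 1) → ∃ i, Q (x i) ∈ P₀)
    {T : Set α} (hT : T.Finite) :
    ∃ h : α → Fin k → ℚ, (∀ i, h 0 i = 0) ∧ (∀ a i, h aᶜ i = 1 - h a i) ∧
      (∀ a ∈ T, ∀ i, 0 ≤ h a i ∧ h a i ≤ 1) ∧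
      (∀ a ∈ T, ∀ b ∈ T, ∀ i, h (a + b) i = min 1 (h a i + h b i)) ∧
      (∀ a, ∀ i j, h (Q a) i = h (Q a) j) ∧
      (∀ a ∈ T, Q a ∈ T → ∀ i, h (Q a) i ≤ h a i) ∧
      (∀ a, ∃ i, h a i = h (Q a) i) ∧
      ∀ a ∈ T, ∀ b ∈ T, Q (aᶜ + b) ∉ P₀ → ∃ i, h a i ≠ h b i := by
  obtain ⟨P, hP, hPc, hPQ⟩ := hQ.exists_primes hW
  let v : ∀ i, α → ChangGroup (P i).Quot := fun i a => ofChain ((P i).proj a)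
  let f : ∀ i, ChangGroup (hQ.restrict P₀).Quot →+ ChangGroup (P i).Quot := fun i =>
    ChangGroup.map (hQ.toQuot (hPc i)) (toQuot_injective hQ _) (by rintro ⟨x⟩ ⟨y⟩; rfl)
      (by rintro ⟨x⟩; rfl) rfl
  have hunit : ∀ i, f i (unit _) = unit _ := fun i => map_unit
  have hfixed : ∀ i c (hc : Q c = c), f i (ofChain ((hQ.restrict P₀).proj ⟨c, hc⟩)) = v i c :=
    fun i c hc => map_ofChain _
  -- The listed elements serve, in order: to normalize by the unit; to bound values below and above;
  -- to see that a sum is truncated, or that it stays at most `1`; and to compare `Q a` with `a` and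
  -- separate distinct values.
  obtain ⟨φ, hφ, hφpos⟩ := exists_compatible_pos (fun i => ChangGroup (P i).Quot)
    (fun i => nonneg _) (fun i g => eq_zero_of_nonneg) (nonneg _) (fun g => eq_zero_of_nonneg) f
    (fun i g => map_nonneg.1)
    (fun i => insert (unit _) ((v i '' T ∪ (fun a => unit _ - v i a) '' T) ∪
      (Set.image2 (fun a b => v i a + v i b - unit _) T T ∪
        (Set.image2 (fun a b => v i (a + b)ᶜ) T T ∪
        Set.image2 (fun a b => v i a - v i b) T T))))
    (fun i => (((hT.image _).union (hT.image _)).union ((hT.image2 _ hT).union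
      ((hT.image2 _ hT).union (hT.image2 _ hT)))).insert _)
  have hsgn : ∀ i, ∀ g ∈ insert (unit _) ((v i '' T ∪ (fun a => unit _ - v i a) '' T) ∪
      (Set.image2 (fun a b => v i a + v i b - unit _) T T ∪
        (Set.image2 (fun a b => v i (a + b)ᶜ) T T ∪
        Set.image2 (fun a b => v i a - v i b) T T))), g ∈ nonneg _ → 0 ≤ φ i g := by
    intro i g hg hnn
    by_cases h0 : g = 0
    · rw [h0, map_zero]
    · exact (hφpos i g hg hnn h0).le
  have hu : ∀ i, 0 < φ i (unit _) := fun i =>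
    hφpos i _ (Set.mem_insert _ _) unit_nonneg unit_ne_zero
  have huu : ∀ i j, φ i (unit _) = φ j (unit _) := fun i j => by
    rw [← hunit, ← hunit, hφ i j]
  have hv1 : ∀ i a, a ∈ T → 0 ≤ φ i (v i a) := fun i a ha =>
    hsgn i _ (Or.inr (Or.inl (Or.inl ⟨a, ha, rfl⟩))) (ofChain_nonneg _)
  have hvc : ∀ i a, v i aᶜ = unit _ - v i a := fun i a => ofChain_compl ((P i).proj a)
  have hv2 : ∀ i a, a ∈ T → φ i (v i a) ≤ φ i (unit _) := fun i a ha => by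
    rw [← sub_nonneg, ← map_sub]
    refine hsgn i _ (Or.inr (Or.inl (Or.inr ⟨a, ha, rfl⟩))) ?_
    rw [← hvc]
    exact ofChain_nonneg _
  refine ⟨fun a i => φ i (v i a) / φ i (unit _), ?_, ?_, ?_, ?_, ?_, ?_, ?_, ?_⟩
  · intro i
    have : v i 0 = 0 := ofChain_zero
    simp [this]
  · intro a i
    simp only [hvc, map_sub, sub_div, div_self (hu i).ne']
  · exact fun a ha i => ⟨div_nonneg (hv1 i a ha) (hu i).le, (div_le_one (hu i)).2 (hv2 i a ha)⟩
  · intro a ha b hb i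
    simp only
    rw [← add_div, ← map_add]
    by_cases hab : (P i).proj a + (P i).proj b = 1
    · have h1 : v i (a + b) = unit _ := by
        simp only [v]
        rw [MVFilter.proj_add, hab, ofChain_one]
      have h2 := hsgn i (v i a + v i b - unit _)
        (Or.inr (Or.inr (Or.inl ⟨a, ha, b, hb, rfl⟩))) (ofChain_add_of_eq hab)
      rw [map_sub, sub_nonneg] at h2
      rw [h1, div_self (hu i).ne', min_eq_left ((one_le_div (hu i)).2 h2)]
    · have h1 : v i (a + b) = v i a + v i b := ofChain_add_of_ne hab
      have h2 := hsgn i (v i (a + b)ᶜ)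
        (Or.inr (Or.inr (Or.inr (Or.inl ⟨a, ha, b, hb, rfl⟩)))) (ofChain_nonneg _)
      rw [hvc, map_sub, sub_nonneg, h1] at h2
      rw [h1, min_eq_right ((div_le_one (hu i)).2 h2)]
  · intro a i j
    simp only
    rw [← hfixed i _ (hQ.idem a), ← hfixed j _ (hQ.idem a), hφ i j, huu i j]
  · intro a ha hQa i
    refine div_le_div_of_nonneg_right ?_ (hu i).le
    rw [← sub_nonneg, ← map_sub]
    refine hsgn i _ (Or.inr (Or.inr (Or.inr (Or.inr ⟨a, ha, Q a, hQa, rfl⟩)))) ?_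
    refine ofChain_sub_of_le ?_
    rw [le_def, ← MVFilter.proj_compl, ← MVFilter.proj_add, le_def.1 (hQ.le a)]
    rfl
  · intro a
    obtain ⟨i, hi⟩ := hPQ a
    refine ⟨i, ?_⟩
    have : (P i).proj a = (P i).proj (Q a) :=
      MVFilter.proj_eq_iff.2 ⟨hi, by rw [le_def.1 (hQ.le a)]; exact (P i).one_mem⟩
    simp only [v, this]
  -- Some `P i` contains `(a → b) → Q (a → b)`. It omits `Q (a → b)`, hence also `a → b`, so `a` and
  -- `b` differ modulo `P i`, and `φ i` is positive at their difference or its negative.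
  · intro a ha b hb hab
    obtain ⟨i, hi⟩ := hPQ (aᶜ + b)
    refine ⟨i, fun h => ?_⟩
    have hmem : aᶜ + b ∉ P i := fun hmem =>
      hab ((hPc i _ (hQ.idem _)).1 ((P i).mp' hmem hi))
    have hne : v i a ≠ v i b := fun heq =>
      hmem (MVFilter.proj_eq_iff.1 (ofChain_injective heq)).1
    have heq : φ i (v i a) = φ i (v i b) := by
      simpa [div_left_inj' (hu i).ne'] using h
    have hpos : ∀ c ∈ T, ∀ d ∈ T, v i c ≠ v i d → φ i (v i c) = φ i (v i d) →
        v i c - v i d ∉ nonneg _ := by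
      intro c hc d hd hcd hφcd hnn
      have := hφpos i _ (Or.inr (Or.inr (Or.inr (Or.inr ⟨c, hc, d, hd, rfl⟩)))) hnn
        (sub_ne_zero.2 hcd)
      rw [map_sub, hφcd, sub_self] at this
      exact this.false
    rcases nonneg_or_neg (v i a - v i b) with h1 | h1
    · exact hpos a ha b hb hne heq h1
    · rw [neg_sub] at h1
      exact hpos b hb a ha hne.symm heq.symm h1

/-! ### From monadic MV-algebras to quantifiers -/

namespace MonadicMV

open FirstOrder MVAlgebra

section Bridge

variable {A : Type*} [lang.Structure A]

/-- The MV-algebra that underlies a monadic MV-algebra. -/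
abbrev IsMV.toMVAlgebra (h : IsMV A) : MVAlgebra A where
  add := oplus
  zero := zero
  compl := neg
  nsmul := @nsmulRec A ⟨zero⟩ ⟨oplus⟩
  add_assoc x y z := (h.add_assoc x y z).symm
  zero_add x := (h.add_comm _ _).trans (h.add_zero x)
  add_zero := h.add_zero
  add_comm := h.add_comm
  compl_compl' := h.neg_neg
  add_compl_zero := h.add_one
  luk := h.lukasiewicz

/-- This is the law `∀(x → ∀y) = ∃x → ∀y` at `y = 0`, as `∀0 = 0`. -/
theorem IsMonadicMV.ex_eq (h : IsMonadicMV A) (x : A) : ex x = neg (all (neg x)) := by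
  let := h.toIsMV.toMVAlgebra
  have hz : all (0 : A) = 0 := le_zero_iff'.1 (h.all_imp_self 0)
  have h1 : all (xᶜ + all (0 : A)) = (ex x)ᶜ + all (0 : A) := h.all_imp_all x 0
  rw [hz, add_zero, add_zero] at h1
  change ex x = (all xᶜ)ᶜ
  rw [h1, cc]

theorem IsMonadicMV.isQuantifier (h : IsMonadicMV A) :
    letI := h.toIsMV.toMVAlgebra
    IsQuantifier (all : A → A) := by
  let := h.toIsMV.toMVAlgebra
  have hle : ∀ x : A, all x ≤ x := h.all_imp_self
  have himp : ∀ x y : A, all ((all x)ᶜ + y) = (all x)ᶜ + all y := h.all_all_imp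
  have hz : all (0 : A) = 0 := le_zero_iff'.1 (hle 0)
  have hex : ∀ x : A, ex x = (all xᶜ)ᶜ := h.ex_eq
  have hc : ∀ x : A, all (all x)ᶜ = (all x)ᶜ := fun x => by
    have := himp x 0
    rwa [hz, add_zero] at this
  refine ⟨hle, himp, fun x y => ?_, fun x => ?_⟩
  -- `∃` fixes `∀x`, so the law for `∃x ∨ y` specializes to `∀x ∨ y`.
  · have hidem : ex (all x) = all x := by rw [hex, hc, cc]
    have : all (ex (all x) ⊔ y) = ex (all x) ⊔ all y := h.all_ex_sup (all x) y
    rwa [hidem] at this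
  · have : ex (xᶜ * xᶜ) = ex xᶜ * ex xᶜ := h.ex_conj_self xᶜ
    rw [hex, hex, cc, compl_mul, cc, ← compl_add] at this
    exact MVAlgebra.compl_injective this

/-- Orthogonality makes the premise of `W_k` equal to `1`, so the join of the `∀ x_i` is `1`, and a
prime filter contains one of them. -/
theorem SatisfiesW.exists_all_mem (h : IsMonadicMV A) {k : ℕ} (hW : SatisfiesW k A) :
    letI := h.toIsMV.toMVAlgebra
    ∀ P : MVFilter A, P.IsPrime → ∀ x : Fin (k + 1) → A, (∀ i j, i ≠ j → x i ⊔ x j = 1) →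
      ∃ i, all (x i) ∈ P := by
  let := h.toIsMV.toMVAlgebra
  intro P hP x hx
  have hbigInf : ∀ l : List A, (∀ a ∈ l, a = 1) → bigInf l = 1 := by
    intro l hl
    induction l with
    | nil => rfl
    | cons a l ih =>
      change a ⊓ bigInf l = 1
      rw [ih fun b hb => hl b (List.mem_cons_of_mem _ hb), hl a List.mem_cons_self, inf_idem]
  have hbigSup : ∀ l : List A, bigSup l ∈ P → ∃ a ∈ l, a ∈ P := by
    intro l hl
    induction l with
    | nil => exact absurd hl hP.zero_notMem
    | cons a l ih =>
      rcases hP.mem_or_mem (show a ⊔ bigSup l ∈ P from hl) with h1 | h1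
      · exact ⟨a, List.mem_cons_self, h1⟩
      · obtain ⟨b, hb, hbP⟩ := ih h1
        exact ⟨b, List.mem_cons_of_mem _ hb, hbP⟩
  have h1 := hW x
  rw [hbigInf] at h1
  · have h2 : (1 : A)ᶜ + bigSup ((List.finRange (k + 1)).map fun i => all (x i)) = 1 := h1
    rw [compl_one, zero_add] at h2
    obtain ⟨a, ha, haP⟩ := hbigSup _ (h2 ▸ P.one_mem')
    obtain ⟨i, -, rfl⟩ := List.mem_map.1 ha
    exact ⟨i, haP⟩
  · intro a ha
    obtain ⟨p, hp, rfl⟩ := List.mem_map.1 ha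
    have hlt : p.1 < p.2 := by simpa using (List.mem_filter.1 hp).2
    change all (x p.1 ⊔ x p.2) = 1
    rw [hx _ _ hlt.ne, h.isQuantifier.one]

end Bridge

/-! ### Functional algebras -/

section Cube

variable {X : Type*} (f g : Cube X) (i : X)

theorem cube_oplus : ((oplus f g i : unitInterval) : ℝ) = min 1 ((f i : ℝ) + g i) := rfl

theorem cube_neg : ((neg f i : unitInterval) : ℝ) = 1 - f i := rfl

theorem cube_zero : (((zero : Cube X) i : unitInterval) : ℝ) = 0 := rfl

theorem cube_one : (((one : Cube X) i : unitInterval) : ℝ) = 1 := by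
  rw [one, cube_neg, cube_zero, sub_zero]

theorem cube_imp : ((imp f g i : unitInterval) : ℝ) = min 1 (1 - (f i : ℝ) + g i) := rfl

theorem cube_conj : ((conj f g i : unitInterval) : ℝ) = max 0 (f i + g i - 1 : ℝ) := by
  rw [conj, cube_neg, cube_oplus, cube_neg, cube_neg]
  rcases le_total (f i + g i : ℝ) 1 with h | h
  · rw [min_eq_left (by linarith), max_eq_left (by linarith)]; ring
  · rw [min_eq_right (by linarith), max_eq_right (by linarith)]; ring

theorem cube_sup : sup f g i = max (f i) (g i) := by
  apply Subtype.ext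
  have h1 := (f i).2.2
  have h2 := (g i).2.1
  rw [sup, cube_imp, cube_imp]
  rcases le_total (f i) (g i) with h | h
  · rw [max_eq_right h]
    have h : (f i : ℝ) ≤ g i := h
    rw [min_eq_left (show (1 : ℝ) ≤ 1 - f i + g i by linarith),
      min_eq_right (by linarith [(g i).2.2])]
    ring
  · rw [max_eq_left h]
    have h : (g i : ℝ) ≤ f i := h
    rw [min_eq_right (show (1 - f i + g i : ℝ) ≤ 1 by linarith), min_eq_right (by linarith)]
    ring

theorem cube_inf : inf f g i = min (f i) (g i) := by
  apply Subtype.ext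
  rw [inf, cube_neg, cube_sup]
  rcases le_total (f i) (g i) with h | h
  · rw [min_eq_left h, max_eq_left, cube_neg]
    · ring
    · change (1 - g i : ℝ) ≤ 1 - f i
      have h : (f i : ℝ) ≤ g i := h
      linarith
  · rw [min_eq_right h, max_eq_right, cube_neg]
    · ring
    · change (1 - f i : ℝ) ≤ 1 - g i
      have h : (g i : ℝ) ≤ f i := h
      linarith

theorem cube_isMV : IsMV (Cube X) where
  add_assoc x y z := by
    funext i; apply Subtype.ext
    have := (x i).2.1; have := (z i).2.1
    simp only [cube_oplus]
    rcases le_total (y i + z i : ℝ) 1 with h1 | h1 <;>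
      rcases le_total (x i + y i : ℝ) 1 with h2 | h2
    · rw [min_eq_right h1, min_eq_right h2, add_assoc]
    · rw [min_eq_right h1, min_eq_left h2, min_eq_left (by linarith), min_eq_left (by linarith)]
    · rw [min_eq_left h1, min_eq_right h2, min_eq_left (by linarith), min_eq_left (by linarith)]
    · rw [min_eq_left h1, min_eq_left h2, min_eq_left (by linarith), min_eq_left (by linarith)]
  add_comm x y := by
    funext i; apply Subtype.ext
    simp only [cube_oplus, add_comm]
  add_zero x := by
    funext i; apply Subtype.ext
    rw [cube_oplus, cube_zero, add_zero, min_eq_right (x i).2.2]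
  neg_neg x := by
    funext i; apply Subtype.ext
    rw [cube_neg, cube_neg, sub_sub_cancel]
  add_one x := by
    funext i; apply Subtype.ext
    rw [cube_oplus, cube_neg, cube_zero, sub_zero, min_eq_left (by linarith [(x i).2.1])]
  lukasiewicz x y := by
    funext i
    change sup x y i = sup y x i
    rw [cube_sup, cube_sup, max_comm]

theorem imp_eq_one_of_le {f g : Cube X} (h : ∀ i, f i ≤ g i) : imp f g = one := by
  funext i; apply Subtype.ext
  have h : (f i : ℝ) ≤ g i := h i
  rw [cube_imp, cube_one, min_eq_left (by linarith)]

theorem cube_exists_all [Finite X] [Nonempty X] : ∃ j, ∀ i, all f i = f j := by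
  obtain ⟨j, hj⟩ := Finite.exists_min f
  exact ⟨j, fun i => le_antisymm (iInf_le _ j) (le_iInf hj)⟩

theorem cube_exists_ex [Finite X] [Nonempty X] : ∃ j, ∀ i, ex f i = f j := by
  obtain ⟨j, hj⟩ := Finite.exists_max f
  exact ⟨j, fun i => le_antisymm (iSup_le hj) (le_iSup f j)⟩

theorem cube_all_le (j : X) : all f i ≤ f j := iInf_le _ j

theorem cube_le_ex (j : X) : f j ≤ ex f i := le_iSup f j

theorem cube_all_unique {j : X} {c : unitInterval} (hj : f j = c) (h : ∀ l, c ≤ f l) :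
    all f i = c := le_antisymm (hj ▸ iInf_le _ j) (le_iInf h)

theorem cube_ex_unique {j : X} {c : unitInterval} (hj : f j = c) (h : ∀ l, f l ≤ c) :
    ex f i = c := le_antisymm (iSup_le h) (hj ▸ le_iSup f j)

theorem cube_isMonadicMV [Finite X] : IsMonadicMV (Cube X) where
  toIsMV := cube_isMV
  all_imp_self x := imp_eq_one_of_le fun i => cube_all_le x i i
  all_imp_all x y := by
    funext i
    have : Nonempty X := ⟨i⟩
    obtain ⟨j, hj⟩ := cube_exists_ex x
    obtain ⟨l, hl⟩ := cube_exists_all y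
    apply cube_all_unique (j := j)
    · apply Subtype.ext
      rw [cube_imp, cube_imp, hl, hl, hj]
    · intro m
      change ((imp (ex x) (all y) i : unitInterval) : ℝ) ≤ (imp x (all y) m : unitInterval)
      have h : (x m : ℝ) ≤ (ex x i : unitInterval) := cube_le_ex x i m
      rw [cube_imp, cube_imp, hl i, hl m]
      exact min_le_min_left _ (by linarith)
  all_all_imp x y := by
    funext i
    have : Nonempty X := ⟨i⟩
    obtain ⟨j, hj⟩ := cube_exists_all x
    obtain ⟨l, hl⟩ := cube_exists_all y
    apply cube_all_unique (j := l)
    · apply Subtype.ext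
      rw [cube_imp, cube_imp, hl, hj, hj]
    · intro m
      change ((imp (all x) (all y) i : unitInterval) : ℝ) ≤ (imp (all x) y m : unitInterval)
      have h : ((all y i : unitInterval) : ℝ) ≤ y m := cube_all_le y i m
      rw [cube_imp, cube_imp, hj i, hj m]
      exact min_le_min_left _ (by linarith)
  all_ex_sup x y := by
    funext i
    have : Nonempty X := ⟨i⟩
    obtain ⟨j, hj⟩ := cube_exists_ex x
    obtain ⟨l, hl⟩ := cube_exists_all y
    apply cube_all_unique (j := l)
    · rw [cube_sup, cube_sup, hl, hj, hj]
    · intro m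
      rw [cube_sup, cube_sup, hj i, hj m]
      exact max_le_max_left _ (cube_all_le y i m)
  ex_conj_self x := by
    funext i
    have : Nonempty X := ⟨i⟩
    obtain ⟨j, hj⟩ := cube_exists_ex x
    apply cube_ex_unique (j := j)
    · apply Subtype.ext
      rw [cube_conj, cube_conj, hj]
    · intro m
      change ((conj x x m : unitInterval) : ℝ) ≤ (conj (ex x) (ex x) i : unitInterval)
      have h : (x m : ℝ) ≤ (ex x i : unitInterval) := cube_le_ex x i m
      rw [cube_conj, cube_conj]
      exact max_le_max_left _ (by linarith)

theorem cube_bigInf_le {l : List (Cube X)} {f : Cube X} (hf : f ∈ l) : bigInf l i ≤ f i := by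
  induction l with
  | nil => cases hf
  | cons a l ih =>
    change inf a (bigInf l) i ≤ f i
    rw [cube_inf]
    rcases List.mem_cons.1 hf with rfl | hf
    · exact min_le_left _ _
    · exact (min_le_right _ _).trans (ih hf)

theorem le_cube_bigSup {l : List (Cube X)} {f : Cube X} (hf : f ∈ l) : f i ≤ bigSup l i := by
  induction l with
  | nil => cases hf
  | cons a l ih =>
    change f i ≤ sup a (bigSup l) i
    rw [cube_sup]
    rcases List.mem_cons.1 hf with rfl | hf
    · exact le_max_left _ _
    · exact (ih hf).trans (le_max_right _ _)

/-- Pigeonhole: of `k + 1` functions on `k` points, two attain their minima at the same point, and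
there their join is the larger of the two minima. -/
theorem cube_satisfiesW (k : ℕ) : SatisfiesW k (Cube (Fin k)) := by
  intro x
  refine imp_eq_one_of_le fun i => ?_
  have : Nonempty (Fin k) := ⟨i⟩
  have h := fun m => cube_exists_all (x m)
  choose j hj using h
  obtain ⟨m, n, hne, hmn⟩ := Fintype.exists_ne_map_eq_of_card_lt j (by simp)
  wlog hlt : m < n generalizing m n
  · exact this n m hne.symm hmn.symm (lt_of_le_of_ne (not_lt.1 hlt) hne.symm)
  calc _ ≤ all (sup (x m) (x n)) i := cube_bigInf_le _ (List.mem_map.2 ⟨(m, n), by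
        simpa [ltPairs] using hlt, rfl⟩)
    _ ≤ sup (x m) (x n) (j m) := cube_all_le _ _ _
    _ = max (all (x m) i) (all (x n) i) := by
        rw [cube_sup, hj, hj, hmn]
    _ ≤ _ := max_le (le_cube_bigSup _ (List.mem_map.2 ⟨m, List.mem_finRange m, rfl⟩))
        (le_cube_bigSup _ (List.mem_map.2 ⟨n, List.mem_finRange n, rfl⟩))

end Cube

/-! ### Identities in the generated quasivariety -/

section Terms

/-- The term algebra. -/
instance : lang.Structure (lang.Term ℕ) where
  funMap f ts := .func f ts
  RelMap r := nomatch r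

variable {A : Type*} [lang.Structure A] (v : ℕ → A) (s t : lang.Term ℕ)

theorem comp_pair {B C : Type*} (φ : B → C) (a b : B) :
    (fun i => φ ((![a, b] : Fin 2 → B) i)) = ![φ a, φ b] := by
  funext i; fin_cases i <;> rfl

theorem comp_single {B C : Type*} (φ : B → C) (a : B) :
    (fun i => φ ((![a] : Fin 1 → B) i)) = ![φ a] := by
  funext i; fin_cases i; rfl

@[simp] theorem realize_oplus : (oplus s t).realize v = oplus (s.realize v) (t.realize v) :=
  congrArg (Language.Structure.funMap (L := lang) Func.add) (comp_pair _ _ _)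

@[simp] theorem realize_neg : (neg s).realize v = neg (s.realize v) :=
  congrArg (Language.Structure.funMap (L := lang) Func.neg) (comp_single _ _)

@[simp] theorem realize_zero : (zero : lang.Term ℕ).realize v = zero :=
  congrArg (Language.Structure.funMap (L := lang) Func.zero) (Subsingleton.elim _ _)

@[simp] theorem realize_ex : (ex s).realize v = ex (s.realize v) :=
  congrArg (Language.Structure.funMap (L := lang) Func.ex) (comp_single _ _)

@[simp] theorem realize_all : (all s).realize v = all (s.realize v) :=
  congrArg (Language.Structure.funMap (L := lang) Func.all) (comp_single _ _)

@[simp] theorem realize_one : (one : lang.Term ℕ).realize v = one := by simp [one]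

@[simp] theorem realize_imp : (imp s t).realize v = imp (s.realize v) (t.realize v) := by
  simp [imp]

@[simp] theorem realize_conj : (conj s t).realize v = conj (s.realize v) (t.realize v) := by
  simp [conj]

@[simp] theorem realize_sup : (sup s t).realize v = sup (s.realize v) (t.realize v) := by
  simp [sup]

@[simp] theorem realize_inf : (inf s t).realize v = inf (s.realize v) (t.realize v) := by
  simp [inf]

@[simp] theorem realize_bigInf (l : List (lang.Term ℕ)) :
    (bigInf l).realize v = bigInf (l.map fun t => t.realize v) := by
  induction l with
  | nil => exact realize_one v
  | cons a l ih => exact (realize_inf v a (bigInf l)).trans (by rw [ih]; rfl)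

@[simp] theorem realize_bigSup (l : List (lang.Term ℕ)) :
    (bigSup l).realize v = bigSup (l.map fun t => t.realize v) := by
  induction l with
  | nil => exact realize_zero v
  | cons a l ih => exact (realize_sup v a (bigSup l)).trans (by rw [ih]; rfl)

theorem realize_eq_of_mem_generated {B : Alg.{v}} {A : Alg.{u}}
    (hA : A ∈ generatedQuasivariety.{u} B) (s t : lang.Term ℕ)
    (h : ∀ v : ℕ → B, s.realize v = t.realize v) (v : ℕ → A) : s.realize v = t.realize v := by
  have hB : B ∈ quasivariety.{v} {⟨[], s, t⟩} := by
    rintro q rfl v -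
    exact h v
  exact Set.mem_iInter₂.1 hA _ hB _ rfl v (by simp)

theorem mem_MMV_of_mem_generated {k : ℕ} {A : Alg.{u}}
    (hA : A ∈ generatedQuasivariety.{u} (stdAlg k)) : A ∈ MMV k := by
  have h := realize_eq_of_mem_generated hA
  have hstd : IsMonadicMV (stdAlg k) := cube_isMonadicMV
  have hW : SatisfiesW k (stdAlg k) := cube_satisfiesW k
  let V : ℕ → lang.Term ℕ := Language.Term.var
  let w (x y z : A) : ℕ → A := fun n => match n with | 0 => x | 1 => y | _ => z
  refine ⟨⟨⟨fun x y z => ?_, fun x y => ?_, fun x => ?_, fun x => ?_, fun x => ?_, fun x y => ?_⟩,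
    fun x => ?_, fun x y => ?_, fun x y => ?_, fun x y => ?_, fun x => ?_⟩, fun x => ?_⟩
  · simpa [V, w] using h (oplus (V 0) (oplus (V 1) (V 2))) (oplus (oplus (V 0) (V 1)) (V 2))
      (fun v => by simpa using hstd.add_assoc _ _ _) (w x y z)
  · simpa [V, w] using h (oplus (V 0) (V 1)) (oplus (V 1) (V 0))
      (fun v => by simpa using hstd.add_comm _ _) (w x y y)
  · simpa [V, w] using h (oplus (V 0) zero) (V 0)
      (fun v => by simpa using hstd.add_zero _) (w x x x)
  · simpa [V, w] using h (neg (neg (V 0))) (V 0)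
      (fun v => by simpa using hstd.neg_neg _) (w x x x)
  · simpa [V, w] using h (oplus (V 0) (neg zero)) (neg zero)
      (fun v => by simpa using hstd.add_one _) (w x x x)
  · simpa [V, w] using h (oplus (neg (oplus (neg (V 0)) (V 1))) (V 1))
      (oplus (neg (oplus (neg (V 1)) (V 0))) (V 0))
      (fun v => by simpa using hstd.lukasiewicz _ _) (w x y y)
  · simpa [V, w] using h (imp (all (V 0)) (V 0)) one
      (fun v => by simpa using hstd.all_imp_self _) (w x x x)
  · simpa [V, w] using h (all (imp (V 0) (all (V 1)))) (imp (ex (V 0)) (all (V 1)))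
      (fun v => by simpa using hstd.all_imp_all _ _) (w x y y)
  · simpa [V, w] using h (all (imp (all (V 0)) (V 1))) (imp (all (V 0)) (all (V 1)))
      (fun v => by simpa using hstd.all_all_imp _ _) (w x y y)
  · simpa [V, w] using h (all (sup (ex (V 0)) (V 1))) (sup (ex (V 0)) (all (V 1)))
      (fun v => by simpa using hstd.all_ex_sup _ _) (w x y y)
  · simpa [V, w] using h (ex (conj (V 0) (V 0))) (conj (ex (V 0)) (ex (V 0)))
      (fun v => by simpa using hstd.ex_conj_self _) (w x x x)
  · have := h (imp
      (bigInf ((ltPairs (k + 1)).map fun p => all (sup (V p.1) (V p.2))))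
      (bigSup ((List.finRange (k + 1)).map fun i : Fin (k + 1) => all (V i)))) one
      (fun v => by
        simpa only [realize_imp, realize_bigInf, realize_bigSup, List.map_map, realize_one,
          Function.comp_def, realize_all, realize_sup, V, Language.Term.realize_var]
          using hW fun i => v i)
      -- Only the first `k + 1` variables occur, so the value `zero` elsewhere is arbitrary.
      (fun n => if hn : n < k + 1 then x ⟨n, hn⟩ else zero)
    simpa only [realize_imp, realize_bigInf, realize_bigSup, List.map_map, realize_one,
      Function.comp_def, realize_all, realize_sup, V, Language.Term.realize_var, Fin.is_lt,
      dite_true, Fin.eta] using this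

end Terms

end MonadicMV

/-! ### Transfer of quasi-identities from the cube -/

namespace MonadicMV

open FirstOrder MVAlgebra

/-- The values of the subterms of a term. -/
def subtermValues {A : Type*} [lang.Structure A] (v : ℕ → A) : lang.Term ℕ → Set A
  | .var n => {v n}
  | .func f ts => insert ((Language.Term.func f ts).realize v) (⋃ i, subtermValues v (ts i))

theorem term_induction {motive : lang.Term ℕ → Prop} (var : ∀ n, motive (.var n))
    (add : ∀ s t, motive s → motive t → motive (oplus s t)) (neg : ∀ s, motive s → motive (neg s))
    (zero : motive zero) (ex : ∀ s, motive s → motive (ex s))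
    (all : ∀ s, motive s → motive (all s)) (t : lang.Term ℕ) : motive t := by
  induction t with
  | var n => exact var n
  | @func n f ts ih =>
    cases f with
    | add =>
      convert add _ _ (ih 0) (ih 1)
      exact congrArg _ (by funext j; fin_cases j <;> rfl)
    | neg =>
      convert neg _ (ih 0)
      exact congrArg _ (by funext j; fin_cases j; rfl)
    | zero =>
      convert zero
      exact congrArg _ (by funext j; exact j.elim0)
    | ex =>
      convert ex _ (ih 0)
      exact congrArg _ (by funext j; fin_cases j; rfl)
    | all =>
      convert all _ (ih 0)
      exact congrArg _ (by funext j; fin_cases j; rfl)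

section

variable {A : Type*} [lang.Structure A] (v : ℕ → A)

theorem subtermValues_finite (t : lang.Term ℕ) : (subtermValues v t).Finite := by
  induction t with
  | var n => exact Set.finite_singleton _
  | func f ts ih => exact (Set.finite_iUnion ih).insert _

theorem realize_mem_subtermValues (t : lang.Term ℕ) : t.realize v ∈ subtermValues v t := by
  cases t with
  | var n => exact rfl
  | func f ts => exact Set.mem_insert _ _

theorem subtermValues_oplus_left (s t : lang.Term ℕ) :
    subtermValues v s ⊆ subtermValues v (oplus s t) := fun _ hx =>
  Set.mem_insert_of_mem _ (Set.mem_iUnion.2 ⟨(0 : Fin 2), hx⟩)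

theorem subtermValues_oplus_right (s t : lang.Term ℕ) :
    subtermValues v t ⊆ subtermValues v (oplus s t) := fun _ hx =>
  Set.mem_insert_of_mem _ (Set.mem_iUnion.2 ⟨(1 : Fin 2), hx⟩)

theorem subtermValues_neg (s : lang.Term ℕ) :
    subtermValues v s ⊆ subtermValues v (neg s) := fun _ hx =>
  Set.mem_insert_of_mem _ (Set.mem_iUnion.2 ⟨(0 : Fin 1), hx⟩)

theorem subtermValues_ex (s : lang.Term ℕ) :
    subtermValues v s ⊆ subtermValues v (ex s) := fun _ hx =>
  Set.mem_insert_of_mem _ (Set.mem_iUnion.2 ⟨(0 : Fin 1), hx⟩)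

theorem subtermValues_all (s : lang.Term ℕ) :
    subtermValues v s ⊆ subtermValues v (all s) := fun _ hx =>
  Set.mem_insert_of_mem _ (Set.mem_iUnion.2 ⟨(0 : Fin 1), hx⟩)

end

theorem holds_of_holds_cube {A : Type u} [lang.Structure A] {k : ℕ} (hA : IsMonadicMV A)
    (hW : SatisfiesW k A) (q : QuasiIdentity) (hq : q.Holds (Cube (Fin k))) : q.Holds A := by
  let := hA.toIsMV.toMVAlgebra
  intro v hv
  have hQ : IsQuantifier (all : A → A) := hA.isQuantifier
  set s := q.conclusion.1 with hs
  set t := q.conclusion.2 with ht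
  let T₀ : Set A := subtermValues v s ∪ subtermValues v t ∪
    ⋃ e ∈ {e | e ∈ q.premises}, (subtermValues v e.1 ∪ subtermValues v e.2)
  have hT₀ : T₀.Finite := by
    refine ((subtermValues_finite v s).union (subtermValues_finite v t)).union ?_
    exact (List.finite_toSet q.premises).biUnion fun e _ =>
      (subtermValues_finite v e.1).union (subtermValues_finite v e.2)
  have hsT : subtermValues v s ⊆ T₀ := fun x hx => Or.inl (Or.inl hx)
  have htT : subtermValues v t ⊆ T₀ := fun x hx => Or.inl (Or.inr hx)
  have hpT : ∀ e ∈ q.premises, subtermValues v e.1 ⊆ T₀ ∧ subtermValues v e.2 ⊆ T₀ := fun e he =>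
    ⟨fun x hx => Or.inr (Set.mem_biUnion he (Or.inl hx)),
      fun x hx => Or.inr (Set.mem_biUnion he (Or.inr hx))⟩
  have key : ∀ x ∈ T₀, ∀ y ∈ T₀, (x = s.realize v ∧ y = t.realize v ∨
      x = t.realize v ∧ y = s.realize v) → x ≤ y := by
    intro x hx y hy hxy
    by_contra hle
    have hd : all (xᶜ + y) ≠ 1 := fun h => hle (one_le_iff.1 (h ▸ hQ.le _))
    obtain ⟨P₀, hP₀, hdP⟩ := MVFilter.exists_isPrime_notMem hd
    -- The elements `aᶜ` and `all aᶜ` join `T₀` because `∃` is computed as `¬∀¬`, and the comparison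
    -- of `∀` with its argument needs both in the finite set.
    obtain ⟨h, h0, hneg, h01, hadd, hconst, hle, hatt, hsep⟩ := hQ.exists_partial_embedding
      (SatisfiesW.exists_all_mem hA hW P₀ hP₀)
      (hT₀.union ((hT₀.image compl).union (hT₀.image fun a => all aᶜ)))
    have hsub : T₀ ⊆ T₀ ∪ (compl '' T₀ ∪ (fun a => all aᶜ) '' T₀) := Set.subset_union_left
    -- Variables outside the terms may have values outside `[0,1]`, hence the clamping; on `T₀` it
    -- changes nothing.
    let w : ℕ → Cube (Fin k) := fun n i => Set.projIcc 0 1 zero_le_one (h (v n) i : ℝ)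
    have hreal : ∀ r : lang.Term ℕ, subtermValues v r ⊆ T₀ → ∀ i,
        ((r.realize w i : unitInterval) : ℝ) = h (r.realize v) i := by
      intro r
      induction r using term_induction with
      | var n =>
        intro hr i
        obtain ⟨h1, h2⟩ := h01 _ (hsub (hr rfl)) i
        exact congrArg Subtype.val
          (Set.projIcc_of_mem zero_le_one ⟨by exact_mod_cast h1, by exact_mod_cast h2⟩)
      | add r r' ih ih' =>
        intro hr i
        have h1 := (subtermValues_oplus_left v r r').trans hr
        have h2 := (subtermValues_oplus_right v r r').trans hr
        rw [realize_oplus, realize_oplus, cube_oplus, ih h1, ih' h2]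
        exact_mod_cast (hadd _ (hsub (h1 (realize_mem_subtermValues v r))) _
          (hsub (h2 (realize_mem_subtermValues v r'))) i).symm
      | neg r ih =>
        intro hr i
        rw [realize_neg, realize_neg, cube_neg, ih ((subtermValues_neg v r).trans hr)]
        exact_mod_cast (hneg _ i).symm
      | zero =>
        intro _ i
        rw [realize_zero, realize_zero, cube_zero]
        exact_mod_cast (h0 i).symm
      | ex r ih =>
        intro hr i
        have h1 := (subtermValues_ex v r).trans hr
        have h2 := h1 (realize_mem_subtermValues v r)
        have hex : ∀ i, h (ex (r.realize v)) i = 1 - h (all (r.realize v)ᶜ) i := fun i => by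
          rw [hA.ex_eq]
          exact hneg _ i
        -- The supremum is attained at the coordinate where the complement attains its minimum.
        obtain ⟨j, hj⟩ := hatt (r.realize v)ᶜ
        rw [hneg] at hj
        have hval : ((r.realize w j : unitInterval) : ℝ) = h (ex (r.realize v)) i := by
          rw [ih h1, hex, hconst _ i j, ← hj, sub_sub_cancel]
        rw [realize_ex, realize_ex, ← hval]
        refine congrArg Subtype.val (cube_ex_unique _ i rfl fun l => ?_)
        rw [← Subtype.coe_le_coe, hval, ih h1, hex, hconst _ i l]
        have hl := hle _ (Or.inr (Or.inl ⟨_, h2, rfl⟩)) (Or.inr (Or.inr ⟨_, h2, rfl⟩)) l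
        rw [hneg] at hl
        exact_mod_cast le_sub_comm.1 hl
      | all r ih =>
        intro hr i
        have h1 := (subtermValues_all v r).trans hr
        have h2 := h1 (realize_mem_subtermValues v r)
        have h3 := hr (realize_mem_subtermValues v _)
        rw [realize_all] at h3
        obtain ⟨j, hj⟩ := hatt (r.realize v)
        have hval : ((r.realize w j : unitInterval) : ℝ) = h (all (r.realize v)) i := by
          rw [ih h1, hj, hconst _ i j]
        rw [realize_all, realize_all, ← hval]
        refine congrArg Subtype.val (cube_all_unique _ i rfl fun l => ?_)
        rw [← Subtype.coe_le_coe, hval, ih h1, hconst _ i l]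
        exact_mod_cast hle _ (hsub h2) (hsub h3) l
    have heq : ∀ r r' : lang.Term ℕ, subtermValues v r ⊆ T₀ → subtermValues v r' ⊆ T₀ →
        (r.realize w = r'.realize w ↔ ∀ i, h (r.realize v) i = h (r'.realize v) i) := by
      intro r r' hr hr'
      simp only [funext_iff, Subtype.ext_iff, hreal r hr, hreal r' hr', Rat.cast_inj]
    have hst := (heq s t hsT htT).1 (hq w fun e he =>
      (heq _ _ (hpT e he).1 (hpT e he).2).2 fun i => by rw [hv e he])
    obtain ⟨i, hi⟩ := hsep x (hsub hx) y (hsub hy) hdP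
    rcases hxy with ⟨rfl, rfl⟩ | ⟨rfl, rfl⟩
    · exact hi (hst i)
    · exact hi (hst i).symm
  have h1 := hsT (realize_mem_subtermValues v s)
  have h2 := htT (realize_mem_subtermValues v t)
  exact le_antisymm (key _ h1 _ h2 (Or.inl ⟨rfl, rfl⟩)) (key _ h2 _ h1 (Or.inr ⟨rfl, rfl⟩))

end MonadicMV

theorem mainTheorem9 (k : ℕ) :
    MonadicMV.MMV.{u} k = MonadicMV.generatedQuasivariety.{u, 0} (MonadicMV.stdAlg k) := by
  refine Set.Subset.antisymm (fun A hA => Set.mem_iInter₂.2 fun S hS q hq => ?_)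
    fun A hA => MonadicMV.mem_MMV_of_mem_generated hA
  exact MonadicMV.holds_of_holds_cube hA.1 hA.2 q (hS q hq)
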